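/- Pseudo-graphs are finite and undirected and may have loops and multiple edges; a loop contributes two to the degree of its vertex. Graphs are pseudo-graphs without loops. A pseudo-graph is cubic if all its degrees are $3$. To $k$-subdivide an edge is to replace it by a path with $k$ new internal vertices. Two edges are adjacent if they are different and share an end. For a graph $G$ let $n$ be its number of vertices and $\nu_i$ the maximum of $|H_1|+\dots+|H_i|$ over all $i$-tuples of pairwise edge-disjoint matchings of $G$; $n_0,n',n_0'$, $\nu_i'$ are the parameters of $G_0,G',G_0'$. Cutting a loop. Let $e$ be a loop of a cubic pseudo-graph $G_0$ at $u_0$, let $f=(u_0,v_0)$ be the edge adjacent to $e$, suppose $v_0$ carries no loop, and let $h=(v_0,u)$, $h'=(v_0,v)$ be the two other edges at $v_0$ (possibly $u=v$). The cubic pseudo-graph $G_0'$ obtained from $G_0$ by cutting the loop $e$ arises by deleting $u_0,v_0$ and adding a new edge $g=(u,v)$. Given a function $k$ on the edges of $G_0$, put $k'(g)=k(h)+k(h')-2$ and $k'(d)=k(d)$ for all other edges $d$ of $G_0'$. The class $\mathfrak M$ consists of all graphs that are obtained from a cubic pseudo-graph, such that the removal of its loops leaves a tree, by $1$-subdividing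 each loop and $2$-subdividing every other edge. Lemma. Let $G_0$ be a connected cubic pseudo-graph, and let $G$ be obtained from $G_0$ by $k(d)$-subdividing each edge $d$, where $k(d)\ge 1$ for every edge $d$ and $k(d)\ge 2$ for every edge $d$ that is not a loop. Then: (a) If $G_0$ contains no loop, then $\nu_2\ge\frac78 n$ and $n\ge 4n_0$. (b) If $G_0$ contains an edge $f$ adjacent to two loops $e$ and $g$, then $G_0$ consists of two vertices joined by the edge $f$, with the loop $e$ at one and the loop $g$ at the other, and $$\frac{\nu_2}{n}=\frac{k(e)+k(f)+k(g)+1}{k(e)+k(f)+k(g)+2}.$$ (c) If $G_0'$ is obtained from $G_0$ by cutting a loop $e$ with adjacent edge $f$, and $G'$ is obtained from $G_0'$ by $k'(d)$-subdividing each edge $d$, then $n_0=n_0'+2$; $n=n'+k(f)+k(e)+4$; $\nu_1\ge\nu_1'+\lfloor k(f)/2\rfloor+\lfloor (k(e)+1)/2\rfloor+1$; and $\nu_2\ge\nu_2'+k(f)+k(e)+3$. (d) $\nu_2\ge\frac56 n$ and $n\ge 3n_0$. (e) If $G_0$ contains a loop $e$ with $k(e)\ge2$, then $\nu_2\ge\frac67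 n$ and $n\ge\frac72 n_0$. The same two inequalities hold if $G_0$ contains an edge $f$ that is not a loop with $k(f)\ge3$. (f) $\nu_1\ge\frac37 n$. (g) If $G\in\mathfrak M$, then $\nu_1\ge\frac6{13}n$. (h) In the situation of (c), if $n'\ge\frac72 n_0'$, then $n\ge\frac72 n_0$. (i) If $n<\frac72 n_0$, then $G\in\mathfrak M$. -/

import Mathlib

/-
Pseudo-graphs (finite undirected graphs in which loops and multiple edges are allowed) are
Mathlib's multigraphs `Graph α β` with finite vertex set `V(G)` and finite edge set `E(G)`.
A graph is a loopless pseudo-graph.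
-/

universe u

namespace Graph

variable {α β α' β' : Type*}

/-- The number `n` of vertices of `G`. -/
noncomputable def order (G : Graph α β) : ℕ := V(G).ncard

/-- The pseudo-graph `G` is finite. -/
structure IsFinite (G : Graph α β) : Prop where
  vertexSet_finite : V(G).Finite
  edgeSet_finite : E(G).Finite

/-- The degree of a vertex: every incident edge counts once, and every loop once more. -/
noncomputable def deg (G : Graph α β) (x : α) : ℕ :=
  (G.incidenceSet x).ncard + (G.loopSet x).ncard

/-- Cubic pseudo-graphs: every vertex has degree three. -/
def IsCubic (G : Graph α β) : Prop := ∀ x ∈ V(G), G.deg x = 3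

/-- Connectedness; loops and multiplicities do not matter for it. In particular, a connected
pseudo-graph has at least one vertex. -/
def IsConnected (G : Graph α β) : Prop := G.toSimpleGraph.Connected

/-- A pseudo-graph is a tree if it has neither loops nor multiple edges and is a tree as a simple
graph. -/
def IsTree (G : Graph α β) : Prop := G.Simple ∧ G.toSimpleGraph.IsTree

/-- The edge `e` is a loop. -/
def IsLoop (G : Graph α β) (e : β) : Prop := ∃ x, G.IsLoopAt e x

/-- The edges `e` and `f` are adjacent: they are different and have a common end. -/
def EdgeAdj (G : Graph α β) (e f : β) : Prop := e ≠ f ∧ ∃ x, G.Inc e x ∧ G.Inc f x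

/-- `G` is the trivial cubic pseudo-graph: two vertices joined by the edge `f`, with a loop `e` at
one of them, a loop `g` at the other one, and nothing else. -/
def IsTrivialCubic (G : Graph α β) (e f g : β) : Prop :=
  e ≠ f ∧ e ≠ g ∧ f ≠ g ∧ E(G) = {e, f, g} ∧
    ∃ x y, x ≠ y ∧ V(G) = {x, y} ∧ G.IsLoopAt e x ∧ G.IsLink f x y ∧ G.IsLoopAt g y

/-! ### Matchings and the parameters `ν_k` -/

/-- A matching: a set of non-loop edges no two of which have a common end. -/
structure IsEdgeMatching (G : Graph α β) (M : Set β) : Prop where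
  subset : M ⊆ E(G)
  not_isLoop : ∀ e ∈ M, ¬ G.IsLoop e
  eq_of_inc : ∀ e ∈ M, ∀ f ∈ M, ∀ x, G.Inc e x → G.Inc f x → e = f

/-- `ν_k`: the maximum of `|H₁| + ⋯ + |H_k|` over all `k`-tuples of pairwise edge-disjoint
matchings of `G`. For finite `G` the set below is non-empty and bounded, so the supremum is a
maximum. -/
noncomputable def nu (k : ℕ) (G : Graph α β) : ℕ :=
  sSup {s | ∃ H : Fin k → Set β, (∀ i, G.IsEdgeMatching (H i)) ∧
    (∀ i j, i ≠ j → Disjoint (H i) (H j)) ∧ s = ∑ i, (H i).ncard}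

/-! ### Subdivisions -/

/-- `G` arises from `G₀` by replacing every edge `d` of `G₀` by a path with `k d` internal
vertices. The map `φ` places the vertices of `G₀` in `G`; the path for `d` has the vertices
`p d 0, …, p d (k d + 1)` and the edges `q d 0, …, q d (k d)`. (For a loop `d` at `x`, both ends of
the path are placed at `φ x`.) The values of `k`, `p`, `q` elsewhere are irrelevant. -/
structure IsSubdivisionVia (G₀ : Graph α β) (k : β → ℕ) (G : Graph α' β')
    (φ : α → α') (p : β → ℕ → α') (q : β → ℕ → β') : Prop where
  injOn_vertex : Set.InjOn φ V(G₀)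
  ends : ∀ d ∈ E(G₀), ∃ x y, G₀.IsLink d x y ∧ p d 0 = φ x ∧ p d (k d + 1) = φ y
  internal_new : ∀ d ∈ E(G₀), ∀ i, 1 ≤ i → i ≤ k d → p d i ∉ φ '' V(G₀)
  internal_inj : ∀ d ∈ E(G₀), ∀ d' ∈ E(G₀), ∀ i i', 1 ≤ i → i ≤ k d → 1 ≤ i' → i' ≤ k d' →
    p d i = p d' i' → d = d' ∧ i = i'
  vertexSet_eq : V(G) = φ '' V(G₀) ∪ {w | ∃ d ∈ E(G₀), ∃ i, 1 ≤ i ∧ i ≤ k d ∧ p d i = w}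
  edge_inj : ∀ d ∈ E(G₀), ∀ d' ∈ E(G₀), ∀ i i', i ≤ k d → i' ≤ k d' →
    q d i = q d' i' → d = d' ∧ i = i'
  edgeSet_eq : E(G) = {c | ∃ d ∈ E(G₀), ∃ i, i ≤ k d ∧ q d i = c}
  isLink : ∀ d ∈ E(G₀), ∀ i, i ≤ k d → G.IsLink (q d i) (p d i) (p d (i + 1))

/-- `G` is (isomorphic to) the pseudo-graph obtained from `G₀` by `k d`-subdividing each edge `d`
of `G₀`. -/
def IsSubdivision (G₀ : Graph α β) (k : β → ℕ) (G : Graph α' β') : Prop :=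
  ∃ φ p q, IsSubdivisionVia G₀ k G φ p q

/-! ### Cutting a loop -/

/-- The pseudo-graph `G` together with one further edge `g` that joins `u` and `v` (used with `g`
not an edge of `G`, and `u`, `v` vertices of `G`). -/
def addLink (G : Graph α β) (g : β) (u v : α) : Graph α β where
  vertexSet := V(G) ∪ {u, v}
  IsLink d x y := (d ≠ g ∧ G.IsLink d x y) ∨ (d = g ∧ s(x, y) = s(u, v))
  isLink_symm d _ := ⟨fun x y h ↦ by
    rcases h with ⟨h₁, h₂⟩ | ⟨h₁, h₂⟩
    · exact Or.inl ⟨h₁, h₂.symm⟩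
    · exact Or.inr ⟨h₁, by rw [Sym2.eq_swap]; exact h₂⟩⟩
  eq_or_eq_of_isLink_of_isLink d x y z w h h' := by
    rcases h with ⟨h₁, h₂⟩ | ⟨h₁, h₂⟩ <;> rcases h' with ⟨h₃, h₄⟩ | ⟨h₃, h₄⟩
    · exact h₂.left_eq_or_eq h₄
    · exact absurd h₃ h₁
    · exact absurd h₁ h₃
    · have := h₂.trans h₄.symm
      rw [Sym2.eq_iff] at this
      tauto
  left_mem_of_isLink d x y h := by
    rcases h with ⟨_, h₂⟩ | ⟨_, h₂⟩
    · exact Or.inl h₂.left_mem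
    · rw [Sym2.eq_iff] at h₂
      right
      simp only [Set.mem_insert_iff, Set.mem_singleton_iff]
      tauto

open Classical in
/-- The subdivision numbers after a loop has been cut: `k h + k h' - 2` for the new edge `g`, and
unchanged for the other edges. -/
noncomputable def cutWeight (k : β → ℕ) (h h' g : β) : β → ℕ :=
  fun d ↦ if d = g then k h + k h' - 2 else k d

/-- The position of a loop that can be cut: `e` is a loop at `u₀`, the edge `f` joins `u₀` with
`v₀`, there is no loop at `v₀`, and `h ≠ h'` are the other edges at `v₀`, leading to `u` and `v`
(which may coincide). -/
structure IsCuttable (G : Graph α β) (e f h h' : β) (u₀ v₀ u v : α) : Prop where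
  loop : G.IsLoopAt e u₀
  ne : u₀ ≠ v₀
  link : G.IsLink f u₀ v₀
  no_loop : ∀ d, ¬ G.IsLoopAt d v₀
  h_ne_h' : h ≠ h'
  h_ne_f : h ≠ f
  h'_ne_f : h' ≠ f
  link_h : G.IsLink h v₀ u
  link_h' : G.IsLink h' v₀ v

/-- `G₀'` is obtained from `G₀` by cutting the loop `e`, whose adjacent edge is `f`: the vertices
`u₀` and `v₀` are deleted and a new edge `g` between `u` and `v` is added. Moreover `k'` is the
function of subdivision numbers on `G₀'` that belongs to the function `k` on `G₀`. The name of the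
new edge `g` is arbitrary, except that it is not the name of a remaining edge. -/
def IsLoopCut (G₀ : Graph α β) (k : β → ℕ) (e f : β) (G₀' : Graph α β) (k' : β → ℕ) : Prop :=
  ∃ (h h' g : β) (u₀ v₀ u v : α), G₀.IsCuttable e f h h' u₀ v₀ u v ∧
    g ∉ E(G₀.deleteVerts {u₀, v₀}) ∧
    G₀' = (G₀.deleteVerts {u₀, v₀}).addLink g u v ∧
    k' = cutWeight k h h' g

/-! ### The class `𝔐` -/

open Classical in
/-- Subdivision numbers `1` for loops and `2` for the other edges. -/
noncomputable def loopWeight (G : Graph α β) : β → ℕ := fun e ↦ if G.IsLoop e then 1 else 2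

/-- The class `𝔐`: all graphs that are obtained from a (finite) cubic pseudo-graph `T₀`, such that
the removal of the loops of `T₀` leaves a tree, by `1`-subdividing each loop and `2`-subdividing
every other edge of `T₀`. (As `T₀` is finite, the universe in which its vertices and edges live
makes no difference.) -/
def InClassM {α β : Type u} (G : Graph α β) : Prop :=
  ∃ (γ δ : Type u) (T₀ : Graph γ δ), T₀.IsFinite ∧ T₀.IsCubic ∧
    (T₀.deleteEdges {e | T₀.IsLoop e}).IsTree ∧ T₀.IsSubdivision T₀.loopWeight G

end Graph

/-! Everything about `ν₂` comes from the identity `2n = 2ν₂ + n₀` (`two_mul_order_eq`), valid for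
connected cubic `G₀` as soon as `k ≥ 1`. As `G` has `n + n₀/2` edges, it says that an optimal pair
of matchings misses exactly `n₀` edges. It misses at least that many: of the three edges of `G` at a
vertex of `G₀` one is missed, and different vertices miss different edges because every edge is
subdivided (`nu_two_add_order_le`). Conversely, one half-edge can be dropped at each vertex so that
all paths can be coloured alternately with two colours (`exists_isPathColoring_two`). The phases of
the paths are chosen along a rooted spanning tree, from the largest rank down to the root; an edge
outside the tree plays the part of the missing parent edge of the root.

The bounds on `n` come from the least admissible weights, `1` on loops and `2` elsewhere. Their sum
is the number of edges plus the number of non-loops, and connectedness forces at least `n₀ - 1`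
non-loops, so `2n ≥ 7n₀ - 2`. A larger weight or one more non-loop already gives `2n ≥ 7n₀`; hence
`2n < 7n₀` leaves only the class `𝔐`.

For `ν₁`, the larger of two matchings gives `ν₁ ≥ ν₂/2`, which suffices if `2n ≥ 7n₀`. In `𝔐` the
tree is 3-edge-coloured, each colour yields a matching of `G`, and the three together have at least
`2(n - n₀)` edges (`six_mul_order_le`). For a cut loop, an optimal matching of `G'` is transferred
to `G` explicitly (`uncutMatching`), while `ν₂` and `ν₂'` are compared through the lower and the
upper half of the identity. -/

namespace Graph

/-! ### Matchings of a subdivision as colourings of its paths -/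

section Coloring
variable {α β α' β' : Type*}

/-- `ι d false` and `ι d true` are the two ends of the edge `d`. -/
def IsOrientation (G : Graph α β) (ι : β → Bool → α) : Prop :=
  ∀ d ∈ E(G), G.IsLink d (ι d false) (ι d true)

lemma exists_isOrientation [Nonempty α] (G : Graph α β) : ∃ ι, G.IsOrientation ι := by
  classical
  have : ∀ d, ∃ xy : α × α, d ∈ E(G) → G.IsLink d xy.1 xy.2 := fun d ↦ by
    by_cases hd : d ∈ E(G)
    · obtain ⟨x, y, h⟩ := exists_isLink_of_mem_edgeSet hd
      exact ⟨(x, y), fun _ ↦ h⟩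
    · exact ⟨Classical.arbitrary _, fun h ↦ absurd h hd⟩
  choose f hf using this
  exact ⟨fun d b ↦ bif b then (f d).2 else (f d).1, fun d hd ↦ hf d hd⟩

/-- A subdivision whose paths run in the direction prescribed by `ι`. -/
structure IsSubdivisionAlong (G₀ : Graph α β) (ι : β → Bool → α) (k : β → ℕ) (G : Graph α' β')
    (φ : α → α') (p : β → ℕ → α') (q : β → ℕ → β') : Prop extends
    IsSubdivisionVia G₀ k G φ p q where
  orient : G₀.IsOrientation ι
  first : ∀ d ∈ E(G₀), p d 0 = φ (ι d false)
  last : ∀ d ∈ E(G₀), p d (k d + 1) = φ (ι d true)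

/-- A path can be traversed backwards, so its direction may be prescribed; later constructions
choose the direction that suits them. -/
lemma IsSubdivisionVia.exists_along {G₀ : Graph α β} {k : β → ℕ} {G : Graph α' β'}
    {φ : α → α'} {p : β → ℕ → α'} {q : β → ℕ → β'} (h : IsSubdivisionVia G₀ k G φ p q)
    {ι : β → Bool → α} (hι : G₀.IsOrientation ι) :
    ∃ p' q', IsSubdivisionAlong G₀ ι k G φ p' q' := by
  classical
  set r : β → Prop := fun d ↦ ¬ (p d 0 = φ (ι d false) ∧ p d (k d + 1) = φ (ι d true)) with hr
  have hrev : ∀ d ∈ E(G₀), r d → p d 0 = φ (ι d true) ∧ p d (k d + 1) = φ (ι d false) := by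
    intro d hd hrd
    obtain ⟨x, y, hl, h0, h1⟩ := h.ends d hd
    rcases hl.eq_and_eq_or_eq_and_eq (hι d hd) with ⟨rfl, rfl⟩ | ⟨rfl, rfl⟩
    · exact absurd ⟨h0, h1⟩ hrd
    · exact ⟨h0, h1⟩
  -- On the paths that run against `ι`, the vertices `0, …, k d + 1` and the edges `0, …, k d` are
  -- renumbered in reverse order.
  set σ : β → ℕ → ℕ := fun d i ↦ if r d then k d + 1 - i else i with hσ
  set τ : β → ℕ → ℕ := fun d i ↦ if r d then k d - i else i with hτ
  have hσ1 : ∀ d i, 1 ≤ i → i ≤ k d → 1 ≤ σ d i ∧ σ d i ≤ k d := by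
    intro d i; simp only [hσ]; split_ifs <;> omega
  have hσσ : ∀ d i, i ≤ k d → σ d (σ d i) = i := by
    intro d i; simp only [hσ]; split_ifs <;> omega
  have hτ1 : ∀ d i, i ≤ k d → τ d i ≤ k d := by
    intro d i; simp only [hτ]; split_ifs <;> omega
  have hττ : ∀ d i, i ≤ k d → τ d (τ d i) = i := by
    intro d i; simp only [hτ]; split_ifs <;> omega
  have hfirst : ∀ d ∈ E(G₀), p d (σ d 0) = φ (ι d false) := by
    intro d hd
    by_cases hd' : r d
    · simpa [hσ, hd'] using (hrev d hd hd').2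
    · simp only [hσ, hd', if_false]; exact (not_not.1 hd').1
  have hlast : ∀ d ∈ E(G₀), p d (σ d (k d + 1)) = φ (ι d true) := by
    intro d hd
    by_cases hd' : r d
    · simpa [hσ, hd'] using (hrev d hd hd').1
    · simp only [hσ, hd', if_false]; exact (not_not.1 hd').2
  refine ⟨fun d i ↦ p d (σ d i), fun d i ↦ q d (τ d i), ⟨h.injOn_vertex, ?_, ?_, ?_, ?_, ?_, ?_, ?_⟩,
    hι, hfirst, hlast⟩
  · exact fun d hd ↦ ⟨_, _, hι d hd, hfirst d hd, hlast d hd⟩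
  · exact fun d hd i h1 h2 ↦ h.internal_new d hd _ (hσ1 d i h1 h2).1 (hσ1 d i h1 h2).2
  · intro d hd d' hd' i i' h1 h2 h3 h4 he
    obtain ⟨rfl, h5⟩ := h.internal_inj d hd d' hd' _ _ (hσ1 d i h1 h2).1 (hσ1 d i h1 h2).2
      (hσ1 d' i' h3 h4).1 (hσ1 d' i' h3 h4).2 he
    exact ⟨rfl, by rw [← hσσ d i h2, h5, hσσ d i' h4]⟩
  · rw [h.vertexSet_eq]
    congr 1
    ext w
    constructor
    · rintro ⟨d, hd, i, h1, h2, rfl⟩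
      exact ⟨d, hd, σ d i, (hσ1 d i h1 h2).1, (hσ1 d i h1 h2).2, by simp only [hσσ d i h2]⟩
    · rintro ⟨d, hd, i, h1, h2, rfl⟩
      exact ⟨d, hd, σ d i, (hσ1 d i h1 h2).1, (hσ1 d i h1 h2).2, rfl⟩
  · intro d hd d' hd' i i' h1 h2 he
    obtain ⟨rfl, h5⟩ := h.edge_inj d hd d' hd' _ _ (hτ1 d i h1) (hτ1 d' i' h2) he
    exact ⟨rfl, by rw [← hττ d i h1, h5, hττ d i' h2]⟩
  · rw [h.edgeSet_eq]
    ext w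
    constructor
    · rintro ⟨d, hd, i, h1, rfl⟩
      exact ⟨d, hd, τ d i, hτ1 d i h1, by simp only [hττ d i h1]⟩
    · rintro ⟨d, hd, i, h1, rfl⟩
      exact ⟨d, hd, τ d i, hτ1 d i h1, rfl⟩
  · intro d hd i hi
    have := h.isLink d hd _ (hτ1 d i hi)
    by_cases hd' : r d
    · simp only [hσ, hτ, hd', if_true] at this ⊢
      rw [show k d + 1 - i = k d - i + 1 by omega, show k d + 1 - (i + 1) = k d - i by omega]
      exact this.symm
    · simpa only [hσ, hτ, hd', if_false] using this

/-- The position of the edge at the end `b` on the path that replaces `d`. -/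
def endPos (k : β → ℕ) (d : β) (b : Bool) : ℕ := bif b then k d else 0

@[simp] lemma endPos_false (k : β → ℕ) (d : β) : endPos k d false = 0 := rfl
@[simp] lemma endPos_true (k : β → ℕ) (d : β) : endPos k d true = k d := rfl

lemma endPos_le (k : β → ℕ) (d : β) (b : Bool) : endPos k d b ≤ k d := by cases b <;> simp

/-- A family of `j` pairwise disjoint matchings of the subdivision of `G₀`: the `i`-th edge of the
path for `d` belongs to the matching `c d i` if `c d i < j`, and to none of them otherwise. -/
structure IsPathColoring (G₀ : Graph α β) (ι : β → Bool → α) (k : β → ℕ) (j : ℕ)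
    (c : β → ℕ → ℕ) : Prop where
  succ_ne : ∀ d ∈ E(G₀), ∀ i < k d, c d i < j → c d i ≠ c d (i + 1)
  end_ne : ∀ d ∈ E(G₀), ∀ d' ∈ E(G₀), ∀ b b', ι d b = ι d' b' → c d (endPos k d b) < j →
    c d (endPos k d b) = c d' (endPos k d' b') → d = d' ∧ b = b'

/-- The number of coloured edges among the first `m + 1` edges of a path. -/
def coloredCount (j m : ℕ) (c : ℕ → ℕ) : ℕ := ((Finset.range (m + 1)).filter (c · < j)).card

namespace IsSubdivisionAlong

variable {G₀ : Graph α β} {ι : β → Bool → α} {k : β → ℕ} {G : Graph α' β'}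
    {φ : α → α'} {p : β → ℕ → α'} {q : β → ℕ → β'}

lemma endVertex (h : IsSubdivisionAlong G₀ ι k G φ p q) {d : β} (hd : d ∈ E(G₀)) (b : Bool) :
    G.Inc (q d (endPos k d b)) (φ (ι d b)) := by
  cases b
  · rw [← h.first d hd]; exact (h.isLink d hd 0 (Nat.zero_le _)).inc_left
  · rw [← h.last d hd]; exact (h.isLink d hd (k d) le_rfl).inc_right

lemma end_mem (h : IsSubdivisionAlong G₀ ι k G φ p q) {d : β} (hd : d ∈ E(G₀)) (b : Bool) :
    ι d b ∈ V(G₀) := by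
  cases b
  · exact (h.orient d hd).left_mem
  · exact (h.orient d hd).right_mem

lemma eq_of_vertex (h : IsSubdivisionAlong G₀ ι k G φ p q) {d d' : β} (hd : d ∈ E(G₀))
    (hd' : d' ∈ E(G₀)) {m m' : ℕ} (hm : m ≤ k d + 1) (hm' : m' ≤ k d' + 1)
    (he : p d m = p d' m') :
    (d = d' ∧ m = m' ∧ 1 ≤ m ∧ m ≤ k d) ∨ ∃ b b', m = (bif b then k d + 1 else 0) ∧
      m' = (bif b' then k d' + 1 else 0) ∧ ι d b = ι d' b' := by
  have hend : ∀ d ∈ E(G₀), ∀ m ≤ k d + 1, ¬ (1 ≤ m ∧ m ≤ k d) →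
      ∃ b : Bool, m = (bif b then k d + 1 else 0) ∧ p d m = φ (ι d b) := by
    intro d hd m hm hn
    rcases Nat.eq_zero_or_pos m with rfl | h0
    · exact ⟨false, rfl, h.first d hd⟩
    · obtain rfl : m = k d + 1 := by omega
      exact ⟨true, rfl, h.last d hd⟩
  by_cases h1 : 1 ≤ m ∧ m ≤ k d <;> by_cases h2 : 1 ≤ m' ∧ m' ≤ k d'
  · obtain ⟨rfl, rfl⟩ := h.internal_inj d hd d' hd' m m' h1.1 h1.2 h2.1 h2.2 he
    exact Or.inl ⟨rfl, rfl, h1⟩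
  · obtain ⟨b, -, hb⟩ := hend d' hd' m' hm' h2
    exact absurd ⟨_, h.end_mem hd' b, (he.trans hb).symm⟩ (h.internal_new d hd m h1.1 h1.2)
  · obtain ⟨b, -, hb⟩ := hend d hd m hm h1
    exact absurd ⟨_, h.end_mem hd b, (he.symm.trans hb).symm⟩ (h.internal_new d' hd' m' h2.1 h2.2)
  · obtain ⟨b, hb, hb'⟩ := hend d hd m hm h1
    obtain ⟨b', hc, hc'⟩ := hend d' hd' m' hm' h2
    exact Or.inr ⟨b, b', hb, hc, h.injOn_vertex (h.end_mem hd b) (h.end_mem hd' b')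
      (hb'.symm.trans (he.trans hc'))⟩

/-- Internal vertices of different paths are distinct, so edges of `G` meet only along one path or
at a vertex of `G₀`. The two alternatives correspond to the two clauses of `IsPathColoring`. -/
lemma inc_cases (h : IsSubdivisionAlong G₀ ι k G φ p q) {d d' : β} (hd : d ∈ E(G₀))
    (hd' : d' ∈ E(G₀)) {i i' : ℕ} (hi : i ≤ k d) (hi' : i' ≤ k d') {w : α'}
    (hw : G.Inc (q d i) w) (hw' : G.Inc (q d' i') w) :
    (d = d' ∧ (i = i' ∨ i = i' + 1 ∨ i' = i + 1)) ∨
      ∃ b b', i = endPos k d b ∧ i' = endPos k d' b' ∧ ι d b = ι d' b' := by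
  have hm : ∃ m, (m = i ∨ m = i + 1) ∧ w = p d m := by
    rcases hw.eq_or_eq_of_isLink (h.isLink d hd i hi) with h1 | h1
    exacts [⟨_, Or.inl rfl, h1⟩, ⟨_, Or.inr rfl, h1⟩]
  have hm' : ∃ m, (m = i' ∨ m = i' + 1) ∧ w = p d' m := by
    rcases hw'.eq_or_eq_of_isLink (h.isLink d' hd' i' hi') with h1 | h1
    exacts [⟨_, Or.inl rfl, h1⟩, ⟨_, Or.inr rfl, h1⟩]
  obtain ⟨m, hm, rfl⟩ := hm
  obtain ⟨m', hm', he⟩ := hm'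
  rcases h.eq_of_vertex hd hd' (by omega) (by omega) he with ⟨h1, h2, -⟩ | ⟨b, b', h1, h2, h3⟩
  · exact Or.inl ⟨h1, by omega⟩
  · refine Or.inr ⟨b, b', ?_, ?_, h3⟩
    · cases b <;> simp at h1 ⊢ <;> omega
    · cases b' <;> simp at h2 ⊢ <;> omega

lemma not_isLoop (h : IsSubdivisionAlong G₀ ι k G φ p q) {d : β} (hd : d ∈ E(G₀)) (hk : 1 ≤ k d)
    {i : ℕ} (hi : i ≤ k d) : ¬ G.IsLoop (q d i) := by
  rintro ⟨w, hw⟩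
  have hl := h.isLink d hd i hi
  have he : p d i = p d (i + 1) := by
    rcases hl.eq_and_eq_or_eq_and_eq hw with ⟨h1, h2⟩ | ⟨h1, h2⟩ <;> rw [h1, h2]
  rcases h.eq_of_vertex hd hd (by omega) (by omega) he with ⟨_, h2, -⟩ | ⟨b, b', h1, h2, -⟩
  · omega
  · cases b <;> cases b' <;> simp at h1 h2 <;> omega

lemma edgeSet_finite (h : IsSubdivisionAlong G₀ ι k G φ p q) (hfin : G₀.IsFinite) :
    E(G).Finite := by
  refine ((hfin.edgeSet_finite.toFinset.sigma fun d ↦ Finset.range (k d + 1)).finite_toSet.image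
    (fun x ↦ q x.1 x.2)).subset ?_
  rw [h.edgeSet_eq]
  rintro _ ⟨d, hd, i, hi, rfl⟩
  exact ⟨⟨d, i⟩, by simpa [Nat.lt_succ_iff] using ⟨hd, hi⟩, rfl⟩

lemma order_eq (h : IsSubdivisionAlong G₀ ι k G φ p q) (hfin : G₀.IsFinite) :
    G.order = G₀.order + ∑ d ∈ hfin.edgeSet_finite.toFinset, k d := by
  classical
  have h1 : {w | ∃ d ∈ E(G₀), ∃ i, 1 ≤ i ∧ i ≤ k d ∧ p d i = w} =
      (((hfin.edgeSet_finite.toFinset.sigma fun d ↦ Finset.Icc 1 (k d)).image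
        fun x ↦ p x.1 x.2 : Finset α') : Set α') := by
    ext w
    simp [and_assoc]
  have h2 : Disjoint (φ '' V(G₀)) {w | ∃ d ∈ E(G₀), ∃ i, 1 ≤ i ∧ i ≤ k d ∧ p d i = w} := by
    rw [Set.disjoint_left]
    rintro w hw ⟨d, hd, i, hi, hi', rfl⟩
    exact h.internal_new d hd i hi hi' hw
  rw [order, h.vertexSet_eq, Set.ncard_union_eq h2 (hfin.vertexSet_finite.image _)
    (by rw [h1]; exact Finset.finite_toSet _), h.injOn_vertex.ncard_image, h1,
    Set.ncard_coe_finset, Finset.card_image_of_injOn, Finset.card_sigma]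
  · simp [order]
  · rintro ⟨d, i⟩ hd ⟨d', i'⟩ hd' he
    simp at hd hd'
    obtain ⟨rfl, rfl⟩ := h.internal_inj d hd.1 d' hd'.1 i i' hd.2.1 hd.2.2 hd'.2.1 hd'.2.2 he
    rfl

lemma bddAbove_nu (h : IsSubdivisionAlong G₀ ι k G φ p q) (hfin : G₀.IsFinite) (j : ℕ) :
    BddAbove {s | ∃ H : Fin j → Set β', (∀ i, G.IsEdgeMatching (H i)) ∧
      (∀ i i', i ≠ i' → Disjoint (H i) (H i')) ∧ s = ∑ i, (H i).ncard} := by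
  refine ⟨j * E(G).ncard, ?_⟩
  rintro s ⟨H, hH, -, rfl⟩
  calc ∑ i, (H i).ncard ≤ ∑ i : Fin j, E(G).ncard :=
        Finset.sum_le_sum fun i _ ↦ Set.ncard_le_ncard (hH i).subset (h.edgeSet_finite hfin)
    _ = _ := by simp

/-- The colour classes are disjoint matchings. The bound `k ≥ 1` ensures that the path replacing a
loop contains no loop. -/
lemma sum_coloredCount_le_nu (h : IsSubdivisionAlong G₀ ι k G φ p q) (hfin : G₀.IsFinite)
    (hk : ∀ d ∈ E(G₀), 1 ≤ k d) {j : ℕ} {c : β → ℕ → ℕ} (hc : G₀.IsPathColoring ι k j c) :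
    ∑ d ∈ hfin.edgeSet_finite.toFinset, coloredCount j (k d) (c d) ≤ G.nu j := by
  classical
  set S : Fin j → Finset (Σ _ : β, ℕ) := fun a ↦
    (hfin.edgeSet_finite.toFinset.sigma fun d ↦ Finset.range (k d + 1)).filter
      (fun x ↦ c x.1 x.2 = a) with hS
  have hmem : ∀ a x, x ∈ S a ↔ x.1 ∈ E(G₀) ∧ x.2 ≤ k x.1 ∧ c x.1 x.2 = a := by
    intro a x; simp [hS, and_assoc]
  have hinj : ∀ x y : (Σ _ : β, ℕ), x.1 ∈ E(G₀) → x.2 ≤ k x.1 → y.1 ∈ E(G₀) → y.2 ≤ k y.1 →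
      q x.1 x.2 = q y.1 y.2 → x = y := by
    rintro ⟨d, i⟩ ⟨d', i'⟩ h1 h2 h3 h4 h5
    obtain ⟨rfl, rfl⟩ := h.edge_inj d h1 d' h3 i i' h2 h4 h5
    rfl
  refine le_csSup (h.bddAbove_nu hfin j) ⟨fun a ↦ ((S a).image fun x ↦ q x.1 x.2 : Finset β'),
    fun a ↦ ⟨?_, ?_, ?_⟩, ?_, ?_⟩
  · intro e he
    simp only [Finset.coe_image, Set.mem_image, Finset.mem_coe, hmem] at he
    obtain ⟨x, ⟨h1, h2, h3⟩, rfl⟩ := he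
    exact (h.isLink _ h1 _ h2).edge_mem
  · intro e he
    simp only [Finset.coe_image, Set.mem_image, Finset.mem_coe, hmem] at he
    obtain ⟨x, ⟨h1, h2, h3⟩, rfl⟩ := he
    exact h.not_isLoop h1 (hk _ h1) h2
  · intro e he f hf w hew hfw
    simp only [Finset.coe_image, Set.mem_image, Finset.mem_coe, hmem] at he hf
    obtain ⟨⟨d, i⟩, ⟨h1, h2, h3⟩, rfl⟩ := he
    obtain ⟨⟨d', i'⟩, ⟨h4, h5, h6⟩, rfl⟩ := hf
    dsimp only at *
    rcases h.inc_cases h1 h4 h2 h5 hew hfw with ⟨rfl, rfl | rfl | rfl⟩ | ⟨b, b', rfl, rfl, hb⟩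
    · rfl
    · exact absurd (h6.trans h3.symm) (hc.succ_ne d h1 i' (by omega) (by omega))
    · exact absurd (h3.trans h6.symm) (hc.succ_ne d h1 i (by omega) (by omega))
    · obtain ⟨rfl, rfl⟩ := hc.end_ne d h1 d' h4 b b' hb (by omega) (by omega)
      rfl
  · intro a a' hne
    rw [Finset.disjoint_coe, Finset.disjoint_left]
    intro e he hf
    simp only [Finset.mem_image, hmem] at he hf
    obtain ⟨x, ⟨h1, h2, h3⟩, rfl⟩ := he
    obtain ⟨y, ⟨h4, h5, h6⟩, h7⟩ := hf
    obtain rfl := hinj _ _ h4 h5 h1 h2 h7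
    exact hne (Fin.ext (h3.symm.trans h6))
  · have h1 : ∀ a, ((((S a).image fun x ↦ q x.1 x.2 : Finset β')) : Set β').ncard = (S a).card := by
      intro a
      rw [Set.ncard_coe_finset, Finset.card_image_of_injOn]
      intro x hx y hy he
      rw [Finset.mem_coe, hmem] at hx hy
      exact hinj _ _ hx.1 hx.2.1 hy.1 hy.2.1 he
    simp only [h1]
    rw [← Finset.card_biUnion]
    · rw [show (∑ d ∈ hfin.edgeSet_finite.toFinset, coloredCount j (k d) (c d)) =
        (hfin.edgeSet_finite.toFinset.sigma fun d ↦
          (Finset.range (k d + 1)).filter (c d · < j)).card by simp [Finset.card_sigma, coloredCount]]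
      congr 1
      ext x
      simp only [Finset.mem_sigma, Finset.mem_biUnion, hmem]
      simp only [Set.Finite.mem_toFinset, Finset.mem_filter, Finset.mem_range, Nat.lt_succ_iff]
      constructor
      · rintro ⟨h1, h2, h3⟩
        exact ⟨⟨_, h3⟩, Finset.mem_univ _, h1, h2, rfl⟩
      · rintro ⟨a, -, h1, h2, h3⟩
        exact ⟨h1, h2, h3 ▸ a.2⟩
    · intro a _ a' _ hne
      rw [Function.onFun, Finset.disjoint_left]
      intro x hx hx'
      rw [hmem] at hx hx'
      exact hne (Fin.ext (hx.2.2.symm.trans hx'.2.2))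

lemma exists_sum_coloredCount_eq_nu (h : IsSubdivisionAlong G₀ ι k G φ p q) (hfin : G₀.IsFinite)
    (hk : ∀ d ∈ E(G₀), 1 ≤ k d) (j : ℕ) : ∃ c, G₀.IsPathColoring ι k j c ∧
    ∑ d ∈ hfin.edgeSet_finite.toFinset, coloredCount j (k d) (c d) = G.nu j := by
  classical
  obtain ⟨H, hH, hdisj, hsum⟩ := Nat.sSup_mem (s := {s | ∃ H : Fin j → Set β',
    (∀ i, G.IsEdgeMatching (H i)) ∧ (∀ i i', i ≠ i' → Disjoint (H i) (H i')) ∧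
      s = ∑ i, (H i).ncard}) ⟨0, fun _ ↦ ∅, fun i ↦ ⟨by simp, by simp, by simp⟩, by simp, by simp⟩
    (h.bddAbove_nu hfin j)
  -- The value `j` marks edges in none of the matchings; disjointness makes the chosen index unique.
  set c : β → ℕ → ℕ := fun d i ↦ if hx : ∃ a : Fin j, q d i ∈ H a then (hx.choose : ℕ) else j with hcdef
  have hc1 : ∀ d i, c d i < j → ∃ a : Fin j, q d i ∈ H a ∧ c d i = a := by
    intro d i hlt
    by_cases hx : ∃ a : Fin j, q d i ∈ H a
    · exact ⟨hx.choose, hx.choose_spec, by simp only [hcdef, dif_pos hx]⟩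
    · simp [hcdef, dif_neg hx] at hlt
  have hc2 : ∀ d i (a : Fin j), q d i ∈ H a → c d i = a := by
    intro d i a ha
    have hx : ∃ a : Fin j, q d i ∈ H a := ⟨a, ha⟩
    simp only [hcdef, dif_pos hx]
    by_contra hne
    exact Set.disjoint_left.1 (hdisj _ _ fun he ↦ hne (congrArg Fin.val he)) hx.choose_spec ha
  have hc3 : ∀ d i d' i' w, c d i < j → c d i = c d' i' → G.Inc (q d i) w → G.Inc (q d' i') w →
      q d i = q d' i' := by
    intro d i d' i' w hlt he hw hw'
    obtain ⟨a, ha, ha'⟩ := hc1 d i hlt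
    obtain ⟨a', hb, hb'⟩ := hc1 d' i' (he ▸ hlt)
    obtain rfl : a = a' := Fin.ext (by omega)
    exact (hH a).eq_of_inc _ ha _ hb w hw hw'
  refine ⟨c, ⟨?_, ?_⟩, ?_⟩
  · intro d hd i hi hlt he
    have := hc3 d i d (i + 1) (p d (i + 1)) hlt he (h.isLink d hd i hi.le).inc_right
      (h.isLink d hd (i + 1) hi).inc_left
    have := (h.edge_inj d hd d hd i (i + 1) hi.le hi this).2
    omega
  · intro d hd d' hd' b b' hb hlt he
    have := hc3 _ _ _ _ (φ (ι d b)) hlt he (h.endVertex hd b) (hb ▸ h.endVertex hd' b')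
    obtain ⟨rfl, h2⟩ := h.edge_inj d hd d' hd' _ _ (endPos_le k d b) (endPos_le k d' b') this
    refine ⟨rfl, ?_⟩
    have := hk d hd
    cases b <;> cases b' <;> simp at h2 ⊢ <;> omega
  · change _ = sSup _
    rw [hsum, show (∑ d ∈ hfin.edgeSet_finite.toFinset, coloredCount j (k d) (c d)) =
        (hfin.edgeSet_finite.toFinset.sigma fun d ↦
          (Finset.range (k d + 1)).filter (c d · < j)).card by simp [Finset.card_sigma, coloredCount]]
    have hHfin : ∀ a, (H a).Finite := fun a ↦ (h.edgeSet_finite hfin).subset (hH a).subset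
    have : ∀ a, (H a).ncard = (hHfin a).toFinset.card := fun a ↦ Set.ncard_eq_toFinset_card _ _
    simp only [this]
    rw [← Finset.card_biUnion]
    · refine Finset.card_bij (fun x _ ↦ q x.1 x.2) ?_ ?_ ?_
      · rintro ⟨d, i⟩ hx
        simp at hx
        obtain ⟨a, ha, -⟩ := hc1 d i hx.2.2
        simp only [Finset.mem_biUnion, Set.Finite.mem_toFinset]
        exact ⟨a, Finset.mem_univ _, ha⟩
      · rintro ⟨d, i⟩ hx ⟨d', i'⟩ hy he
        simp at hx hy
        obtain ⟨rfl, rfl⟩ := h.edge_inj d hx.1 d' hy.1 i i' hx.2.1 hy.2.1 he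
        rfl
      · intro e he
        simp only [Finset.mem_biUnion, Set.Finite.mem_toFinset] at he
        obtain ⟨a, -, ha⟩ := he
        have hE := (hH a).subset ha
        rw [h.edgeSet_eq] at hE
        obtain ⟨d, hd, i, hi, rfl⟩ := hE
        refine ⟨⟨d, i⟩, ?_, rfl⟩
        simp only [Finset.mem_sigma, Set.Finite.mem_toFinset, Finset.mem_filter, Finset.mem_range,
          Nat.lt_succ_iff]
        exact ⟨hd, hi, by rw [hc2 d i a ha]; exact a.2⟩
    · intro a _ a' _ hne
      rw [Function.onFun, Finset.disjoint_left]
      intro x hx hx'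
      simp only [Set.Finite.mem_toFinset] at hx hx'
      exact Set.disjoint_left.1 (hdisj a a' hne) hx hx'

end IsSubdivisionAlong

lemma IsSubdivision.congr {G₀ : Graph α β} {k k' : β → ℕ} {G : Graph α' β'}
    (h : G₀.IsSubdivision k G) (hk : ∀ d ∈ E(G₀), k d = k' d) : G₀.IsSubdivision k' G := by
  obtain ⟨φ, p, q, h⟩ := h
  refine ⟨φ, p, q, h.injOn_vertex, fun d hd ↦ ?_, fun d hd i h1 h2 ↦ ?_,
    fun d hd d' hd' i i' h1 h2 h3 h4 ↦ ?_, ?_, fun d hd d' hd' i i' h1 h2 ↦ ?_, ?_,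
    fun d hd i hi ↦ ?_⟩
  · rw [← hk d hd]; exact h.ends d hd
  · exact h.internal_new d hd i h1 (hk d hd ▸ h2)
  · exact h.internal_inj d hd d' hd' i i' h1 (hk d hd ▸ h2) h3 (hk d' hd' ▸ h4)
  · rw [h.vertexSet_eq]
    congr 1
    ext w
    exact exists_congr fun d ↦ and_congr_right fun hd ↦ by rw [hk d hd]
  · exact h.edge_inj d hd d' hd' i i' (hk d hd ▸ h1) (hk d' hd' ▸ h2)
  · rw [h.edgeSet_eq]
    ext w
    exact exists_congr fun d ↦ and_congr_right fun hd ↦ by rw [hk d hd]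
  · exact h.isLink d hd i (hk d hd ▸ hi)

end Coloring

/-! ### Half-edges and rooted spanning trees -/

section Counting
variable {α β : Type*} {G : Graph α β} {ι : β → Bool → α}

open Classical in
/-- The half-edges `(d, b)` at the vertex `x`. -/
noncomputable def halfEdges (hfin : G.IsFinite) (ι : β → Bool → α) (x : α) : Finset (β × Bool) :=
  (hfin.edgeSet_finite.toFinset ×ˢ Finset.univ).filter fun h ↦ ι h.1 h.2 = x

@[simp] lemma mem_halfEdges {hfin : G.IsFinite} {x : α} {h : β × Bool} :
    h ∈ halfEdges hfin ι x ↔ h.1 ∈ E(G) ∧ ι h.1 h.2 = x := by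
  simp [halfEdges]

lemma IsOrientation.inc (hι : G.IsOrientation ι) {d : β} (hd : d ∈ E(G)) (b : Bool) :
    G.Inc d (ι d b) := by
  cases b
  exacts [(hι d hd).inc_left, (hι d hd).inc_right]

lemma IsOrientation.inc_iff (hι : G.IsOrientation ι) {d : β} (hd : d ∈ E(G)) {x : α} :
    G.Inc d x ↔ ∃ b, ι d b = x := by
  constructor
  · intro h
    rcases h.eq_or_eq_of_isLink (hι d hd) with rfl | rfl
    exacts [⟨_, rfl⟩, ⟨_, rfl⟩]
  · rintro ⟨b, rfl⟩
    exact hι.inc hd b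

lemma IsOrientation.isLoopAt_iff (hι : G.IsOrientation ι) {d : β} (hd : d ∈ E(G)) {x : α} :
    G.IsLoopAt d x ↔ ι d false = x ∧ ι d true = x := by
  rw [← isLink_self_iff, (hι d hd).isLink_iff]
  constructor
  · rintro (⟨h, h'⟩ | ⟨h, h'⟩) <;> exact ⟨by simp [h], by simp [h']⟩
  · exact fun h ↦ Or.inl h

lemma IsOrientation.isLoop_iff (hι : G.IsOrientation ι) {d : β} (hd : d ∈ E(G)) :
    G.IsLoop d ↔ ι d false = ι d true := by
  constructor
  · rintro ⟨x, hx⟩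
    obtain ⟨h1, h2⟩ := (hι.isLoopAt_iff hd).1 hx
    rw [h1, h2]
  · exact fun h ↦ ⟨ι d true, (hι.isLoopAt_iff hd).2 ⟨h, rfl⟩⟩

lemma IsLoop.edge_mem {d : β} (h : G.IsLoop d) : d ∈ E(G) := by
  obtain ⟨x, hx⟩ := h
  exact hx.edge_mem

/-- Let `A b` be the edges whose end `b` is `x`. Incident edges form the union of `A false` and `A
true`, loops their intersection, and the two cardinalities add up to the number of half-edges. -/
lemma card_halfEdges (hfin : G.IsFinite) (hι : G.IsOrientation ι) (x : α) :
    (halfEdges hfin ι x).card = G.deg x := by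
  classical
  set A : Bool → Finset β := fun b ↦ hfin.edgeSet_finite.toFinset.filter fun d ↦ ι d b = x
  have hA : ∀ b d, d ∈ A b ↔ d ∈ E(G) ∧ ι d b = x := by intro b d; simp [A]
  have h1 : G.incidenceSet x = (A false ∪ A true : Finset β) := by
    ext d
    simp only [mem_incidenceSet, Finset.coe_union, Set.mem_union, Finset.mem_coe, hA]
    constructor
    · intro h
      obtain ⟨b, hb⟩ := (hι.inc_iff h.edge_mem).1 h
      cases b
      exacts [Or.inl ⟨h.edge_mem, hb⟩, Or.inr ⟨h.edge_mem, hb⟩]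
    · rintro (⟨h, rfl⟩ | ⟨h, rfl⟩) <;> exact hι.inc h _
  have h2 : G.loopSet x = (A false ∩ A true : Finset β) := by
    ext d
    simp only [mem_loopSet, Finset.coe_inter, Set.mem_inter_iff, Finset.mem_coe, hA]
    constructor
    · intro h
      have := (hι.isLoopAt_iff h.edge_mem).1 h
      exact ⟨⟨h.edge_mem, this.1⟩, h.edge_mem, this.2⟩
    · rintro ⟨⟨h, h3⟩, -, h4⟩
      exact (hι.isLoopAt_iff h).2 ⟨h3, h4⟩
  rw [deg, h1, h2, Set.ncard_coe_finset, Set.ncard_coe_finset, Finset.card_union_add_card_inter]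
  have h3 : halfEdges hfin ι x = (A false ×ˢ {false}) ∪ (A true ×ˢ {true}) := by
    ext ⟨d, b⟩
    cases b <;> simp [hA]
  rw [h3, Finset.card_union_of_disjoint]
  · simp
  · rw [Finset.disjoint_left]
    rintro ⟨d, b⟩ h h'
    simp at h h'
    grind

lemma IsCubic.card_halfEdges (hc : G.IsCubic) (hfin : G.IsFinite) (hι : G.IsOrientation ι) {x : α}
    (hx : x ∈ V(G)) : (halfEdges hfin ι x).card = 3 := by
  rw [Graph.card_halfEdges hfin hι, hc x hx]

lemma IsCubic.eq_of_ne (hc : G.IsCubic) (hfin : G.IsFinite) (hι : G.IsOrientation ι)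
    {x : α} (hx : x ∈ V(G)) {h₁ h₂ h₃ h : β × Bool} (hh₁ : h₁ ∈ halfEdges hfin ι x)
    (hh₂ : h₂ ∈ halfEdges hfin ι x) (hh₃ : h₃ ∈ halfEdges hfin ι x)
    (hh : h ∈ halfEdges hfin ι x) (h₁₂ : h₁ ≠ h₂) (h₁₃ : h₁ ≠ h₃) (h₂₃ : h₂ ≠ h₃) :
    h = h₁ ∨ h = h₂ ∨ h = h₃ := by
  classical
  have h4 : ({h₁, h₂, h₃} : Finset (β × Bool)) = halfEdges hfin ι x := by
    apply Finset.eq_of_subset_of_card_le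
    · intro y hy
      simp only [Finset.mem_insert, Finset.mem_singleton] at hy
      rcases hy with rfl | rfl | rfl <;> assumption
    · rw [hc.card_halfEdges hfin hι hx, Finset.card_eq_three.2 ⟨h₁, h₂, h₃, h₁₂, h₁₃, h₂₃, rfl⟩]
  rw [← h4] at hh
  simpa using hh

lemma IsCubic.exists_third (hc : G.IsCubic) (hfin : G.IsFinite) (hι : G.IsOrientation ι)
    {x : α} (hx : x ∈ V(G)) (h₁ h₂ : β × Bool) :
    ∃ h ∈ halfEdges hfin ι x, h ≠ h₁ ∧ h ≠ h₂ := by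
  classical
  by_contra! hcon
  have : halfEdges hfin ι x ⊆ {h₁, h₂} := by
    intro h hh
    by_cases h1 : h = h₁
    · simp [h1]
    · simp [hcon h hh h1]
  have := (Finset.card_le_card this).trans Finset.card_le_two
  rw [hc.card_halfEdges hfin hι hx] at this
  omega

lemma IsCubic.three_mul_order (hc : G.IsCubic) (hfin : G.IsFinite) (hι : G.IsOrientation ι) :
    3 * G.order = 2 * hfin.edgeSet_finite.toFinset.card := by
  classical
  have h1 := Finset.card_eq_sum_card_fiberwise
    (s := hfin.edgeSet_finite.toFinset ×ˢ (Finset.univ : Finset Bool))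
    (t := hfin.vertexSet_finite.toFinset) (f := fun h ↦ ι h.1 h.2) (by
      rintro ⟨d, b⟩ h
      simp at h ⊢
      exact (hι.inc h b).vertex_mem)
  have h2 : ∀ x ∈ hfin.vertexSet_finite.toFinset, ((hfin.edgeSet_finite.toFinset ×ˢ
      (Finset.univ : Finset Bool)).filter (fun h ↦ ι h.1 h.2 = x)).card = 3 := by
    intro x hx
    rw [← hc.card_halfEdges hfin hι ((Set.Finite.mem_toFinset _).1 hx), halfEdges]
  rw [Finset.sum_congr rfl h2] at h1
  simp at h1
  rw [order, Set.ncard_eq_toFinset_card _ hfin.vertexSet_finite]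
  omega

/-- Every vertex `x ≠ r` has an edge `t x` in `S` to a vertex of smaller rank. -/
structure IsSearchTree (G : Graph α β) (S : Set β) (r : α) (t : α → β) (ρ : α → ℕ) : Prop where
  root_mem : r ∈ V(G)
  mem : ∀ x ∈ V(G), x ≠ r → t x ∈ S
  exists_parent : ∀ x ∈ V(G), x ≠ r → ∃ y, G.IsLink (t x) x y ∧ ρ y < ρ x
  root_lt : ∀ x ∈ V(G), x ≠ r → ρ r < ρ x

/-- The simple graph in which two vertices are adjacent if an edge in `S` joins them. -/
def linkGraph (G : Graph α β) (S : Set β) : SimpleGraph α where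
  Adj x y := x ≠ y ∧ ∃ d ∈ S, G.IsLink d x y
  symm := ⟨fun _ _ h ↦ ⟨h.1.symm, h.2.imp fun _ hd ↦ ⟨hd.1, hd.2.symm⟩⟩⟩
  loopless := ⟨fun _ h ↦ h.1 rfl⟩

lemma _root_.SimpleGraph.Walk.exists_adj_dist_lt {H : SimpleGraph α} {x r : α} (w : H.Walk x r)
    (hne : x ≠ r) : ∃ y, H.Adj x y ∧ H.dist y r < w.length := by
  cases w with
  | nil => exact absurd rfl hne
  | cons hadj w => exact ⟨_, hadj, Nat.lt_succ_of_le (SimpleGraph.dist_le w)⟩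

/-- The rank is the distance to `r` through edges of `S`; the first edge of a shortest walk to `r`
leads to a vertex of smaller rank. -/
lemma exists_isSearchTree [Nonempty β] {S : Set β} {r : α} (hr : r ∈ V(G))
    (h : ∀ x ∈ V(G), (G.linkGraph S).Reachable x r) : ∃ t ρ, G.IsSearchTree S r t ρ := by
  classical
  have key : ∀ x, ∃ d, x ∈ V(G) → x ≠ r → d ∈ S ∧ ∃ y, G.IsLink d x y ∧
      (G.linkGraph S).dist y r < (G.linkGraph S).dist x r := by
    intro x
    by_cases hx : x ∈ V(G) ∧ x ≠ r
    · obtain ⟨w, hw⟩ := (h x hx.1).exists_walk_length_eq_dist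
      obtain ⟨y, ⟨-, d, hd, hl⟩, hlt⟩ := w.exists_adj_dist_lt hx.2
      exact ⟨d, fun _ _ ↦ ⟨hd, _, hl, hw ▸ hlt⟩⟩
    · exact ⟨Classical.arbitrary β, fun h1 h2 ↦ absurd ⟨h1, h2⟩ hx⟩
  choose t ht using key
  refine ⟨t, fun x ↦ (G.linkGraph S).dist x r, hr, fun x hx hxr ↦ (ht x hx hxr).1,
    fun x hx hxr ↦ (ht x hx hxr).2, fun x hx hxr ↦ ?_⟩
  rw [SimpleGraph.dist_self]
  exact (h x hx).pos_dist_of_ne hxr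

lemma IsConnected.nonempty (h : G.IsConnected) : V(G).Nonempty :=
  let ⟨x⟩ := SimpleGraph.Connected.nonempty h; ⟨x, x.2⟩

lemma IsConnected.reachable (h : G.IsConnected) {x y : α} (hx : x ∈ V(G)) (hy : y ∈ V(G)) :
    (G.linkGraph E(G)).Reachable x y := by
  let f : G.toSimpleGraph →g G.linkGraph E(G) :=
    { toFun := Subtype.val
      map_rel' := by
        rintro ⟨x, hx⟩ ⟨y, hy⟩ hxy
        simp only [toSimpleGraph_adj] at hxy
        obtain ⟨hne, d, hd⟩ := hxy
        exact ⟨fun he ↦ hne (by simpa using he), d, hd.edge_mem, hd⟩ }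
  exact (SimpleGraph.Connected.preconnected h ⟨x, hx⟩ ⟨y, hy⟩).map f

namespace IsSearchTree

variable {S : Set β} {r : α} {t : α → β} {ρ : α → ℕ}

lemma reachable (h : G.IsSearchTree S r t ρ) {x : α} (hx : x ∈ V(G)) :
    (G.linkGraph S).Reachable x r := by
  induction hn : ρ x using Nat.strong_induction_on generalizing x with
  | _ n ih =>
    by_cases hxr : x = r
    · rw [hxr]
    · obtain ⟨y, hl, hlt⟩ := h.exists_parent x hx hxr
      have h1 : (G.linkGraph S).Adj x y :=
        ⟨fun he ↦ by rw [he] at hlt; omega, _, h.mem x hx hxr, hl⟩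
      exact h1.reachable.trans (ih _ (by omega) hl.right_mem rfl)

/-- Two vertices sharing a parent edge would be each other's parents, against the strict decrease of
rank. -/
lemma injOn (h : G.IsSearchTree S r t ρ) : Set.InjOn t (V(G) \ {r}) := by
  rintro x ⟨hx, hxr⟩ y ⟨hy, hyr⟩ he
  obtain ⟨x', hl, hlt⟩ := h.exists_parent x hx hxr
  obtain ⟨y', hl', hlt'⟩ := h.exists_parent y hy hyr
  rw [he] at hl
  rcases hl.eq_and_eq_or_eq_and_eq hl' with ⟨h1, -⟩ | ⟨rfl, rfl⟩
  · exact h1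
  · omega

lemma not_isLoop (h : G.IsSearchTree S r t ρ) {x : α} (hx : x ∈ V(G)) (hxr : x ≠ r) :
    ¬ G.IsLoop (t x) := by
  rintro ⟨z, hz⟩
  obtain ⟨y, hl, hlt⟩ := h.exists_parent x hx hxr
  rcases hl.eq_and_eq_or_eq_and_eq hz with ⟨rfl, rfl⟩ | ⟨rfl, rfl⟩ <;> omega

lemma order_le_ncard (h : G.IsSearchTree S r t ρ) (hfin : G.IsFinite) {N : Set β} (hN : N.Finite)
    (ht : ∀ x ∈ V(G), x ≠ r → t x ∈ N) : G.order ≤ N.ncard + 1 := by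
  rw [order, ← Set.ncard_sdiff_singleton_add_one h.root_mem hfin.vertexSet_finite,
    ← h.injOn.ncard_image]
  gcongr
  rintro _ ⟨x, hx, rfl⟩
  exact ht x hx.1 hx.2

end IsSearchTree

end Counting

/-! ### The identity for two matchings -/

section PairOfMatchings
variable {α β α' β' : Type*} {G₀ : Graph α β} {ι : β → Bool → α} {k : β → ℕ} {G : Graph α' β'}
  {φ : α → α'} {p : β → ℕ → α'} {q : β → ℕ → β'}

/-- The conditions at vertices of larger rank are met first. None of them involves the edge of `κ
x`, so its phase is still free and can be set to settle the condition at `x`. -/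
lemma exists_phase (s : Finset α) (ρ : α → ℕ) (κ a : α → β × Bool) (w : β × Bool → ℕ)
    (h₁ : ∀ x ∈ s, (κ x).1 ≠ (a x).1)
    (h₂ : ∀ x ∈ s, ∀ z ∈ s, x ≠ z → ρ x ≤ ρ z → (κ x).1 ≠ (κ z).1 ∧ (κ x).1 ≠ (a z).1) :
    ∃ θ : β → ℕ, ∀ x ∈ s, (θ (κ x).1 + w (κ x)) % 2 ≠ (θ (a x).1 + w (a x)) % 2 := by
  classical
  induction s using Finset.induction_on_min_value ρ with
  | empty => exact ⟨0, by simp⟩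
  | insert x s hx hmin ih =>
    obtain ⟨θ, hθ⟩ := ih (fun y hy ↦ h₁ y (Finset.mem_insert_of_mem hy))
      (fun y hy z hz ↦ h₂ y (Finset.mem_insert_of_mem hy) z (Finset.mem_insert_of_mem hz))
    refine ⟨Function.update θ (κ x).1 (θ (a x).1 + w (a x) + 1 + w (κ x)), ?_⟩
    intro z hz
    rcases Finset.mem_insert.1 hz with rfl | hz'
    · rw [Function.update_self, Function.update_of_ne (h₁ z hz).symm]
      omega
    · obtain ⟨h3, h4⟩ := h₂ x (Finset.mem_insert_self _ _) z hz (fun he ↦ hx (he ▸ hz'))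
        (hmin z hz')
      rw [Function.update_of_ne h3.symm, Function.update_of_ne h4.symm]
      exact hθ z hz'

lemma coloredCount_add_card (j m : ℕ) (c : ℕ → ℕ) :
    coloredCount j m c + ((Finset.range (m + 1)).filter (¬ c · < j)).card = m + 1 := by
  rw [coloredCount, Finset.card_filter_add_card_filter_not, Finset.card_range]

lemma exists_isPathColoring_two (hfin : G₀.IsFinite) (hconn : G₀.IsConnected) (hcubic : G₀.IsCubic)
    (hι : G₀.IsOrientation ι) (k : β → ℕ) :
    ∃ c, G₀.IsPathColoring ι k 2 c ∧ ∑ d ∈ hfin.edgeSet_finite.toFinset, (k d + 1) ≤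
      ∑ d ∈ hfin.edgeSet_finite.toFinset, coloredCount 2 (k d) (c d) + G₀.order := by
  classical
  obtain ⟨r₁, hr₁⟩ := hconn.nonempty
  have hcard := hcubic.three_mul_order hfin hι
  have hpos : 0 < G₀.order := by
    rw [order, Set.ncard_pos hfin.vertexSet_finite]; exact ⟨r₁, hr₁⟩
  have hE : 0 < hfin.edgeSet_finite.toFinset.card := by omega
  have hne : Nonempty β := ⟨(Finset.card_pos.1 hE).choose⟩
  obtain ⟨t₁, ρ₁, ht₁⟩ := exists_isSearchTree hr₁ (S := E(G₀)) fun x hx ↦ hconn.reachable hx hr₁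
  -- `d₀` is an edge whose removal does not disconnect the pseudo-graph.
  obtain ⟨d₀, hd₀, hd₀t⟩ : ∃ d₀ ∈ E(G₀), ∀ x ∈ V(G₀), x ≠ r₁ → t₁ x ≠ d₀ := by
    -- A spanning tree uses only `n₀ - 1` of the `3n₀/2` edges.
    by_contra! hcon
    have h1 : E(G₀) ⊆ t₁ '' (V(G₀) \ {r₁}) := by
      intro d hd
      obtain ⟨x, hx, hxr, rfl⟩ := hcon d hd
      exact ⟨x, ⟨hx, hxr⟩, rfl⟩
    have h2 := Set.ncard_le_ncard h1 ((hfin.vertexSet_finite.sdiff).image _)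
    have h3 := Set.ncard_image_le (f := t₁) (hfin.vertexSet_finite.sdiff (t := {r₁}))
    have h4 := Set.ncard_sdiff_singleton_add_one hr₁ hfin.vertexSet_finite
    rw [Set.ncard_eq_toFinset_card _ hfin.edgeSet_finite] at h2
    rw [order] at hcard
    omega
  have ht₁' : G₀.IsSearchTree (E(G₀) \ {d₀}) r₁ t₁ ρ₁ :=
    ⟨ht₁.root_mem, fun x hx hxr ↦ ⟨ht₁.mem x hx hxr, hd₀t x hx hxr⟩, ht₁.exists_parent, ht₁.root_lt⟩
  -- Rooting the tree at an end of `d₀` lets the half-edge `(d₀, false)` act as the parent half-edge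
  -- of the root.
  set r := ι d₀ false with hr
  have hrV : r ∈ V(G₀) := (hι.inc hd₀ false).vertex_mem
  obtain ⟨t, ρ, ht⟩ := exists_isSearchTree hrV (S := E(G₀) \ {d₀}) fun x hx ↦
    (ht₁'.reachable hx).trans (ht₁'.reachable hrV).symm
  have hκ : ∀ x, ∃ h : β × Bool, x ∈ V(G₀) → h ∈ halfEdges hfin ι x ∧ (x = r → h = (d₀, false)) ∧
      (x ≠ r → h.1 = t x) := by
    intro x
    by_cases hx : x ∈ V(G₀)
    · by_cases hxr : x = r
      · exact ⟨(d₀, false), fun _ ↦ ⟨by simp [hd₀, hxr, hr], fun _ ↦ rfl, fun h ↦ absurd hxr h⟩⟩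
      · obtain ⟨y, hl, -⟩ := ht.exists_parent x hx hxr
        obtain ⟨b, hb⟩ := (hι.inc_iff hl.edge_mem).1 hl.inc_left
        exact ⟨(t x, b), fun _ ↦ ⟨by simp [hl.edge_mem, hb], fun h ↦ absurd h hxr, fun _ ↦ rfl⟩⟩
    · exact ⟨(d₀, false), fun h ↦ absurd h hx⟩
  choose κ hκ using hκ
  -- The half-edge dropped at `x`. Dropping `(d₀, true)` at its vertex leaves the root as the only
  -- constraint on the phase of `d₀`; this also works if `d₀` is a loop.
  have hrem : ∀ x, ∃ h : β × Bool, x ∈ V(G₀) → h ∈ halfEdges hfin ι x ∧ h ≠ κ x ∧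
      (x = ι d₀ true → h = (d₀, true)) := by
    intro x
    by_cases hx : x ∈ V(G₀)
    · by_cases hxy : x = ι d₀ true
      · refine ⟨(d₀, true), fun _ ↦ ⟨by simp [hd₀, hxy], fun h ↦ ?_, fun _ ↦ rfl⟩⟩
        by_cases hxr : x = r
        · have := h.trans ((hκ x hx).2.1 hxr)
          simp at this
        · have := (hκ x hx).2.2 hxr
          rw [← h] at this
          exact (ht.mem x hx hxr).2 this.symm
      · obtain ⟨h, h1, h2, -⟩ := hcubic.exists_third hfin hι hx (κ x) (κ x)
        exact ⟨h, fun _ ↦ ⟨h1, h2, fun h ↦ absurd h hxy⟩⟩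
    · exact ⟨(d₀, false), fun h ↦ absurd h hx⟩
  choose rem hrem using hrem
  have ha : ∀ x, ∃ h : β × Bool, x ∈ V(G₀) → h ∈ halfEdges hfin ι x ∧ h ≠ κ x ∧ h ≠ rem x := by
    intro x
    by_cases hx : x ∈ V(G₀)
    · obtain ⟨h, h1⟩ := hcubic.exists_third hfin hι hx (κ x) (rem x)
      exact ⟨h, fun _ ↦ h1⟩
    · exact ⟨(d₀, false), fun h ↦ absurd h hx⟩
  choose a ha using ha
  -- The two kept half-edges at `x` lie on different edges: tree edges are not loops, and at the
  -- root the other half of `d₀`, if it is there, is dropped.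
  have h1 : ∀ x ∈ V(G₀), (κ x).1 ≠ (a x).1 := by
    intro x hx he
    obtain ⟨hκ1, hκ2, hκ3⟩ := hκ x hx
    obtain ⟨ha1, ha2, ha3⟩ := ha x hx
    rw [mem_halfEdges] at ha1 hκ1
    by_cases hxr : x = r
    · have hκx := hκ2 hxr
      have hax : a x = (d₀, true) := by
        rw [hκx] at he ha2
        rcases hh : a x with ⟨d, b⟩
        rw [hh] at he ha2
        cases b <;> simp_all
      rw [hax] at ha1 ha3
      exact ha3 ((hrem x hx).2.2 ha1.2.symm).symm
    · refine ht.not_isLoop hx hxr ?_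
      have hb : (κ x).2 ≠ (a x).2 := fun h ↦ ha2 (Prod.ext he.symm h.symm)
      rw [← hκ3 hxr, hι.isLoop_iff hκ1.1]
      rw [← he] at ha1
      have h2 := hκ1.2
      have h3 := ha1.2
      cases hb1 : (κ x).2 <;> cases hb2 : (a x).2 <;> simp_all
  -- The parent edge of `x` ends elsewhere only at a vertex of smaller rank, and `d₀` is kept only
  -- at the root.
  have h2 : ∀ x ∈ V(G₀), ∀ z ∈ V(G₀), x ≠ z → ρ x ≤ ρ z →
      ∀ h ∈ halfEdges hfin ι z, h ≠ rem z → (κ x).1 ≠ h.1 := by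
    rintro x hx z hz hne hle ⟨d, b⟩ hh hhr rfl
    rw [mem_halfEdges] at hh
    dsimp only at hh
    by_cases hxr : x = r
    · have hκx := (hκ x hx).2.1 hxr
      rw [hκx] at hh hhr
      cases b
      · exact hne (hxr.trans hh.2)
      · exact hhr ((hrem z hz).2.2 hh.2.symm).symm
    · obtain ⟨y, hl, hlt⟩ := ht.exists_parent x hx hxr
      have hκx := (hκ x hx).2.2 hxr
      rw [hκx] at hh
      have := hι.inc hh.1 b
      rw [hh.2] at this
      rcases this.eq_or_eq_of_isLink hl with rfl | rfl
      · exact hne rfl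
      · omega
  obtain ⟨θ, hθ⟩ := exists_phase hfin.vertexSet_finite.toFinset ρ κ a (fun h ↦ endPos k h.1 h.2)
    (by simpa using h1) (by
      intro x hx z hz hne hle
      rw [Set.Finite.mem_toFinset] at hx hz
      exact ⟨h2 x hx z hz hne hle _ (hκ z hz).1 (hrem z hz).2.1.symm,
        h2 x hx z hz hne hle _ (ha z hz).1 (ha z hz).2.2⟩)
  set R : β × Bool → Prop := fun h ↦ ∃ x ∈ V(G₀), rem x = h with hR
  -- Colour `2` means uncoloured: only end edges at dropped half-edges are left out, and all other
  -- edges alternate.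
  set c : β → ℕ → ℕ := fun d i ↦ if ∃ b, R (d, b) ∧ i = endPos k d b then 2 else (θ d + i) % 2
    with hcdef
  have hc1 : ∀ d i, c d i < 2 → c d i = (θ d + i) % 2 := by
    intro d i h
    simp only [hcdef] at h ⊢
    split_ifs at h ⊢
    · omega
    · rfl
  have hc2 : ∀ d b, c d (endPos k d b) < 2 → ¬ R (d, b) := by
    intro d b h hRd
    simp only [hcdef] at h
    rw [if_pos ⟨b, hRd, rfl⟩] at h
    omega
  refine ⟨c, ⟨?_, ?_⟩, ?_⟩
  · intro d hd i hi hlt he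
    have h3 := hc1 d i hlt
    have h4 := hc1 d (i + 1) (he ▸ hlt)
    omega
  · intro d hd d' hd' b b' hb hlt he
    have hx : ι d b ∈ V(G₀) := (hι.inc hd b).vertex_mem
    have hx' := hx
    generalize hxdef : ι d b = x at hb hx hx'
    have hcase : ∀ d ∈ E(G₀), ∀ b, ι d b = x → c d (endPos k d b) < 2 →
        (d, b) = κ x ∨ (d, b) = a x := by
      intro d hd b hdx hlt
      rcases hcubic.eq_of_ne hfin hι hx (hκ x hx).1 (ha x hx).1 (hrem x hx).1
        (h := (d, b)) (by simp [hd, hdx]) (ha x hx).2.1.symm (hrem x hx).2.1.symm (ha x hx).2.2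
        with h | h | h
      · exact Or.inl h
      · exact Or.inr h
      · exact absurd ⟨x, hx, h.symm⟩ (hc2 d b hlt)
    have h3 := hcase d hd b hxdef hlt
    have h4 := hcase d' hd' b' hb.symm (he ▸ hlt)
    have h5 := hc1 _ _ hlt
    have h6 := hc1 _ _ (he ▸ hlt : c d' (endPos k d' b') < 2)
    have h7 := hθ x (by simpa using hx)
    rw [← Prod.mk.injEq]
    rcases h3 with h3 | h3 <;> rcases h4 with h4 | h4
    · rw [h3, h4]
    · rw [← h3, ← h4] at h7
      dsimp only at h7
      omega
    · rw [← h3, ← h4] at h7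
      dsimp only at h7
      omega
    · rw [h3, h4]
  · have h3 : G₀.order = ∑ d ∈ hfin.edgeSet_finite.toFinset,
        (hfin.vertexSet_finite.toFinset.filter fun x ↦ (rem x).1 = d).card := by
      rw [order, Set.ncard_eq_toFinset_card _ hfin.vertexSet_finite]
      apply Finset.card_eq_sum_card_fiberwise
      intro x hx
      have hx' : x ∈ V(G₀) := by simpa using hx
      have := (hrem x hx').1
      rw [mem_halfEdges] at this
      simpa using this.1
    rw [h3, ← Finset.sum_add_distrib]
    refine Finset.sum_le_sum fun d hd ↦ ?_
    rw [← coloredCount_add_card 2 (k d) (c d)]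
    gcongr
    refine (Finset.card_le_card ?_).trans (Finset.card_image_le
      (f := fun x ↦ endPos k d (rem x).2))
    intro i hi
    simp only [Finset.mem_filter] at hi
    have : ∃ b, R (d, b) ∧ i = endPos k d b := by
      by_contra hcon
      have := hi.2
      simp only [hcdef, if_neg hcon] at this
      omega
    obtain ⟨b, ⟨x, hx, hxd⟩, rfl⟩ := this
    simp only [Finset.mem_image, Finset.mem_filter, Set.Finite.mem_toFinset]
    exact ⟨x, ⟨hx, by rw [hxd]⟩, by rw [hxd]⟩

lemma IsSubdivisionAlong.two_mul_order_le (h : IsSubdivisionAlong G₀ ι k G φ p q)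
    (hfin : G₀.IsFinite) (hconn : G₀.IsConnected) (hcubic : G₀.IsCubic)
    (hk : ∀ d ∈ E(G₀), 1 ≤ k d) : 2 * G.order ≤ 2 * G.nu 2 + G₀.order := by
  obtain ⟨c, hc, hsum⟩ := exists_isPathColoring_two hfin hconn hcubic h.orient k
  have h1 := h.sum_coloredCount_le_nu hfin hk hc
  have h2 := h.order_eq hfin
  have h3 := hcubic.three_mul_order hfin h.orient
  rw [Finset.sum_add_distrib, Finset.sum_const, smul_eq_mul, mul_one] at hsum
  omega

/-- By pigeonhole, two colours leave one of three half-edges at each vertex uncoloured. Neither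
connectedness nor exact cubicity is needed, so this applies directly after a cut. -/
lemma IsSubdivisionAlong.nu_two_add_order_le (h : IsSubdivisionAlong G₀ ι k G φ p q)
    (hfin : G₀.IsFinite) (hk : ∀ d ∈ E(G₀), 1 ≤ k d)
    (hdeg : ∀ x ∈ V(G₀), 3 ≤ (halfEdges hfin ι x).card) :
    G.nu 2 + G₀.order ≤ ∑ d ∈ hfin.edgeSet_finite.toFinset, (k d + 1) := by
  classical
  obtain ⟨c, hc, hsum⟩ := h.exists_sum_coloredCount_eq_nu hfin hk 2
  have hu : ∀ x : V(G₀), ∃ u ∈ halfEdges hfin ι (x : α), ¬ c u.1 (endPos k u.1 u.2) < 2 := by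
    rintro ⟨x, hx⟩
    by_contra! hcon
    have h1 := Finset.card_le_card_of_injOn (s := halfEdges hfin ι x) (t := Finset.range 2)
      (fun u ↦ c u.1 (endPos k u.1 u.2)) (fun u hu ↦ by simpa using hcon u hu) (by
        rintro ⟨d, b⟩ hu ⟨d', b'⟩ hu' he
        have h2 := mem_halfEdges.1 (Finset.mem_coe.1 hu)
        have h3 := mem_halfEdges.1 (Finset.mem_coe.1 hu')
        obtain ⟨rfl, rfl⟩ := hc.end_ne d h2.1 d' h3.1 b b' (h2.2.trans h3.2.symm)
          (hcon _ (Finset.mem_coe.1 hu)) he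
        rfl)
    have h2 := hdeg x hx
    rw [Finset.card_range] at h1
    omega
  choose u hu hu' using hu
  have hfinV : Finite V(G₀) := hfin.vertexSet_finite
  have := Fintype.ofFinite V(G₀)
  have h3 : G₀.order = ∑ d ∈ hfin.edgeSet_finite.toFinset,
      (Finset.univ.filter fun x ↦ (u x).1 = d).card := by
    rw [order, ← Nat.card_coe_set_eq, Nat.card_eq_fintype_card, ← Finset.card_univ]
    apply Finset.card_eq_sum_card_fiberwise
    intro x _
    simpa using (mem_halfEdges.1 (hu x)).1
  rw [← hsum, h3, ← Finset.sum_add_distrib]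
  refine Finset.sum_le_sum fun d hd ↦ ?_
  rw [← coloredCount_add_card 2 (k d) (c d)]
  gcongr
  refine Finset.card_le_card_of_injOn (fun x ↦ endPos k (u x).1 (u x).2) ?_ ?_
  · intro x hx
    simp only [Finset.coe_filter, Finset.mem_univ, true_and, Set.mem_ofPred_eq] at hx
    have h4 := hu' x
    have h5 := endPos_le k (u x).1 (u x).2
    simp only [hx] at h4 h5 ⊢
    simpa [Nat.lt_succ_iff] using ⟨h5, by simpa using h4⟩
  · intro x hx y hy he
    simp only [Finset.coe_filter, Finset.mem_univ, true_and, Set.mem_ofPred_eq] at hx hy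
    have h4 := mem_halfEdges.1 (hu x)
    have h5 := mem_halfEdges.1 (hu y)
    have h6 := hk d (by simpa using hd)
    -- Since `k d ≥ 1`, the two end edges of one path are different.
    have h7 : (u x).2 = (u y).2 := by
      cases hb : (u x).2 <;> cases hb' : (u y).2 <;> simp [hx, hy, hb, hb'] at he ⊢ <;> omega
    exact Subtype.ext (by rw [← h4.2, ← h5.2, hx, hy, h7])

lemma IsSubdivisionAlong.two_mul_order_eq (h : IsSubdivisionAlong G₀ ι k G φ p q)
    (hfin : G₀.IsFinite) (hconn : G₀.IsConnected) (hcubic : G₀.IsCubic)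
    (hk : ∀ d ∈ E(G₀), 1 ≤ k d) : 2 * G.order = 2 * G.nu 2 + G₀.order := by
  refine le_antisymm (h.two_mul_order_le hfin hconn hcubic hk) ?_
  have h1 := h.nu_two_add_order_le hfin hk fun x hx ↦
    (hcubic.card_halfEdges hfin h.orient hx).ge
  have h2 := h.order_eq hfin
  have h3 := hcubic.three_mul_order hfin h.orient
  rw [Finset.sum_add_distrib, Finset.sum_const, smul_eq_mul, mul_one] at h1
  omega

lemma IsSubdivisionAlong.nu_two_le (h : IsSubdivisionAlong G₀ ι k G φ p q)
    (hfin : G₀.IsFinite) (hk : ∀ d ∈ E(G₀), 1 ≤ k d) : G.nu 2 ≤ 2 * G.nu 1 := by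
  obtain ⟨c, hc, hsum⟩ := h.exists_sum_coloredCount_eq_nu hfin hk 2
  -- Each colour class by itself is a single matching; the guard `a < 2` keeps the uncoloured edges
  -- from counting as a class.
  have key : ∀ a, G₀.IsPathColoring ι k 1 (fun d i ↦ if c d i = a ∧ a < 2 then 0 else 1) := by
    intro a
    refine ⟨?_, ?_⟩
    · intro d hd i hi h1 h2
      have := hc.succ_ne d hd i hi
      split_ifs at h1 h2 <;> omega
    · intro d hd d' hd' b b' hb h1 h2
      refine hc.end_ne d hd d' hd' b b' hb ?_ ?_ <;> split_ifs at h1 h2 <;> omega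
  have h0 := h.sum_coloredCount_le_nu hfin hk (key 0)
  have h1 := h.sum_coloredCount_le_nu hfin hk (key 1)
  rw [← hsum, two_mul]
  refine le_trans ?_ (add_le_add h0 h1)
  rw [← Finset.sum_add_distrib]
  refine Finset.sum_le_sum fun d _ ↦ ?_
  simp only [coloredCount]
  refine (Finset.card_le_card ?_).trans (Finset.card_union_le _ _)
  intro i
  simp only [Finset.mem_filter, Finset.mem_union]
  rintro ⟨hi, hlt⟩
  have : c d i = 0 ∨ c d i = 1 := by omega
  rcases this with h | h <;> simp [h, hi]

end PairOfMatchings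

/-! ### Pseudo-graphs that become trees when their loops are removed -/

section LoopTree
variable {α β : Type*} {G : Graph α β} {ι : β → Bool → α}

lemma IsCubic.nonempty_edge (hc : G.IsCubic) (hV : V(G).Nonempty) : Nonempty β := by
  obtain ⟨x, hx⟩ := hV
  by_contra hcon
  have h1 : IsEmpty β := not_nonempty_iff.1 hcon
  have h2 := hc x hx
  simp [deg, Set.eq_empty_of_isEmpty] at h2

open Classical in
lemma sum_loopWeight (hfin : G.IsFinite) :
    ∑ d ∈ hfin.edgeSet_finite.toFinset, G.loopWeight d =
      hfin.edgeSet_finite.toFinset.card + {d ∈ E(G) | ¬ G.IsLoop d}.ncard := by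
  have h1 : {d ∈ E(G) | ¬ G.IsLoop d} =
      (hfin.edgeSet_finite.toFinset.filter fun d ↦ ¬ G.IsLoop d : Finset β) := by
    ext d; simp
  rw [h1, Set.ncard_coe_finset, Finset.card_filter, Finset.card_eq_sum_ones,
    ← Finset.sum_add_distrib]
  refine Finset.sum_congr rfl fun d _ ↦ ?_
  by_cases h : G.IsLoop d <;> simp [loopWeight, h]

lemma exists_isSearchTree_of_isConnected [Nonempty β] (hconn : G.IsConnected) :
    ∃ r t ρ, G.IsSearchTree E(G) r t ρ := by
  obtain ⟨r, hr⟩ := hconn.nonempty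
  obtain ⟨t, ρ, h⟩ := exists_isSearchTree hr (S := E(G)) fun x hx ↦ hconn.reachable hx hr
  exact ⟨r, t, ρ, h⟩

lemma IsConnected.order_le (hconn : G.IsConnected) [Nonempty β] (hfin : G.IsFinite) :
    G.order ≤ {d ∈ E(G) | ¬ G.IsLoop d}.ncard + 1 := by
  obtain ⟨r, t, ρ, h⟩ := exists_isSearchTree_of_isConnected hconn
  exact h.order_le_ncard hfin (hfin.edgeSet_finite.subset fun _ hd ↦ hd.1)
    fun x hx hxr ↦ ⟨h.mem x hx hxr, h.not_isLoop hx hxr⟩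

lemma IsSearchTree.image_eq {S : Set β} {r : α} {t : α → β} {ρ : α → ℕ} {N : Set β}
    (h : G.IsSearchTree S r t ρ) (hfin : G.IsFinite) (hN : N.Finite)
    (ht : ∀ x ∈ V(G), x ≠ r → t x ∈ N) (hcard : N.ncard + 1 ≤ G.order) :
    t '' (V(G) \ {r}) = N := by
  apply Set.eq_of_subset_of_ncard_le _ _ hN
  · rintro _ ⟨x, hx, rfl⟩
    exact ht x hx.1 hx.2
  · rw [h.injOn.ncard_image]
    rw [order, ← Set.ncard_sdiff_singleton_add_one h.root_mem hfin.vertexSet_finite] at hcard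
    omega

/-- The injective map `t` already uses `n - 1` edges, so every edge is a parent edge. This excludes
loops and parallel edges and leaves at most `n - 1` adjacent pairs. -/
lemma IsSearchTree.isTree {r : α} {t : α → β} {ρ : α → ℕ} (h : G.IsSearchTree E(G) r t ρ)
    (hfin : G.IsFinite) (hcard : E(G).ncard + 1 ≤ G.order) : G.IsTree := by
  classical
  have hsurj := h.image_eq hfin hfin.edgeSet_finite h.mem hcard
  have hedge : ∀ d ∈ E(G), ∃ z ∈ V(G), z ≠ r ∧ t z = d := by
    intro d hd
    rw [← hsurj] at hd
    obtain ⟨z, hz, hzd⟩ := hd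
    exact ⟨z, hz.1, hz.2, hzd⟩
  have hpar : ∀ x : V(G), ∃ y : V(G), (x : α) ≠ r → G.IsLink (t x) x y ∧ ρ y < ρ x := by
    intro x
    by_cases hxr : (x : α) = r
    · exact ⟨x, fun h ↦ absurd hxr h⟩
    · obtain ⟨y, hl, hlt⟩ := h.exists_parent x x.2 hxr
      exact ⟨⟨y, hl.right_mem⟩, fun _ ↦ ⟨hl, hlt⟩⟩
  choose par hpar using hpar
  have hsimple : G.Simple :=
    { not_isLoopAt := by
        intro d x hd
        obtain ⟨z, hz, hzr, rfl⟩ := hedge d hd.edge_mem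
        exact h.not_isLoop hz hzr ⟨x, hd⟩
      eq_of_isLink := by
        intro d d' x y hl hl'
        obtain ⟨z, hz, hzr, rfl⟩ := hedge d hl.edge_mem
        obtain ⟨z', hz', hzr', rfl⟩ := hedge d' hl'.edge_mem
        obtain ⟨w, hw, hlt⟩ := h.exists_parent z hz hzr
        obtain ⟨w', hw', hlt'⟩ := h.exists_parent z' hz' hzr'
        rcases hl.eq_and_eq_or_eq_and_eq hw with ⟨rfl, rfl⟩ | ⟨rfl, rfl⟩ <;>
          rcases hl'.eq_and_eq_or_eq_and_eq hw' with ⟨h1, h2⟩ | ⟨h1, h2⟩ <;> subst h1 h2 <;>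
          first | rfl | omega }
  refine ⟨hsimple, ?_⟩
  have hadj : ∀ x : V(G), (x : α) ≠ r → G.toSimpleGraph.Adj x (par x) := by
    intro x hxr
    obtain ⟨hl, hlt⟩ := hpar x hxr
    rw [toSimpleGraph_adj_iff]
    exact hl.adj
  have hreach : ∀ n, ∀ x : V(G), ρ x = n → G.toSimpleGraph.Reachable x ⟨r, h.root_mem⟩ := by
    intro n
    induction n using Nat.strong_induction_on with
    | _ n ih =>
      intro x hx
      by_cases hxr : (x : α) = r
      · obtain rfl : x = ⟨r, h.root_mem⟩ := Subtype.ext hxr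
        rfl
      · exact (hadj x hxr).reachable.trans (ih _ (hx ▸ (hpar x hxr).2) _ rfl)
  have hfinV : Finite V(G) := hfin.vertexSet_finite
  have hC : G.toSimpleGraph.Connected :=
    { preconnected := fun x y ↦ (hreach _ x rfl).trans (hreach _ y rfl).symm
      nonempty := ⟨⟨r, h.root_mem⟩⟩ }
  refine SimpleGraph.isTree_iff_connected_and_card.2 ⟨hC, le_antisymm ?_
    hC.card_vert_le_card_edgeSet_add_one⟩
  have hsub : G.toSimpleGraph.edgeSet ⊆
      (fun x ↦ s(x, par x)) '' ({⟨r, h.root_mem⟩}ᶜ : Set V(G)) := by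
    intro e
    induction e using Sym2.inductionOn with
    | _ x y =>
      intro hxy
      rw [SimpleGraph.mem_edgeSet, toSimpleGraph_adj_iff] at hxy
      obtain ⟨d, hl⟩ := hxy
      obtain ⟨z, hz, hzr, rfl⟩ := hedge d hl.edge_mem
      obtain ⟨hw, hlt⟩ := hpar ⟨z, hz⟩ hzr
      refine ⟨⟨z, hz⟩, fun he ↦ hzr (congrArg Subtype.val he), ?_⟩
      rcases hl.eq_and_eq_or_eq_and_eq hw with ⟨h1, h2⟩ | ⟨h1, h2⟩
      · exact Sym2.eq_iff.2 (Or.inl ⟨Subtype.ext h1.symm, Subtype.ext h2.symm⟩)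
      · exact Sym2.eq_iff.2 (Or.inr ⟨Subtype.ext h2.symm, Subtype.ext h1.symm⟩)
  have h1 := (Set.ncard_le_ncard hsub (Set.toFinite _)).trans (Set.ncard_image_le (Set.toFinite _))
  have h2 := Set.ncard_sdiff_singleton_add_one (Set.mem_univ (⟨r, h.root_mem⟩ : V(G)))
    (Set.toFinite _)
  rw [← Set.compl_eq_univ_sdiff, Set.ncard_univ] at h2
  rw [Nat.card_coe_set_eq, ← h2]
  exact Nat.add_le_add_right h1 1

lemma IsTree.ncard_edgeSet_add_one_le (h : G.IsTree) (hfin : G.IsFinite) :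
    E(G).ncard + 1 ≤ G.order := by
  obtain ⟨hsimple, htree⟩ := h
  have hfinV : Finite V(G) := hfin.vertexSet_finite
  have hcard := (SimpleGraph.isTree_iff_connected_and_card.1 htree).2
  have hf : ∀ d : E(G), ∃ e : G.toSimpleGraph.edgeSet, ∃ x y : V(G),
      G.IsLink d x y ∧ (e : Sym2 V(G)) = s(x, y) := by
    rintro ⟨d, hd⟩
    obtain ⟨x, y, hl⟩ := exists_isLink_of_mem_edgeSet hd
    exact ⟨⟨s(⟨x, hl.left_mem⟩, ⟨y, hl.right_mem⟩), (toSimpleGraph_adj_iff _ _).2 hl.adj⟩,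
      _, _, hl, rfl⟩
  choose f hf using hf
  have hinj : Function.Injective f := by
    intro d d' he
    obtain ⟨x, y, hl, h1⟩ := hf d
    obtain ⟨x', y', hl', h2⟩ := hf d'
    rw [← he, h1, Sym2.eq_iff] at h2
    rcases h2 with ⟨rfl, rfl⟩ | ⟨rfl, rfl⟩
    · exact Subtype.ext (hl.eq hl')
    · exact Subtype.ext (hl.eq hl'.symm)
  rw [order, ← Nat.card_coe_set_eq, ← Nat.card_coe_set_eq, ← hcard]
  exact Nat.add_le_add_right (Nat.card_le_card_of_injective f hinj) 1

lemma IsFinite.deleteEdges (hfin : G.IsFinite) (F : Set β) : (G.deleteEdges F).IsFinite :=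
  ⟨hfin.vertexSet_finite, hfin.edgeSet_finite.subset (by simp)⟩

lemma edgeSet_deleteEdges_isLoop :
    E(G.deleteEdges {e | G.IsLoop e}) = {d ∈ E(G) | ¬ G.IsLoop d} := by
  ext d; simp

lemma isTree_deleteEdges_isLoop (hconn : G.IsConnected) [Nonempty β] (hfin : G.IsFinite)
    (hcard : {d ∈ E(G) | ¬ G.IsLoop d}.ncard + 1 ≤ G.order) :
    (G.deleteEdges {e | G.IsLoop e}).IsTree := by
  obtain ⟨r, t, ρ, h⟩ := exists_isSearchTree_of_isConnected hconn
  have h' : (G.deleteEdges {e | G.IsLoop e}).IsSearchTree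
      E(G.deleteEdges {e | G.IsLoop e}) r t ρ := by
    refine ⟨h.root_mem, fun x hx hxr ↦ ?_, fun x hx hxr ↦ ?_, h.root_lt⟩
    · rw [edgeSet_deleteEdges_isLoop]
      exact ⟨h.mem x hx hxr, h.not_isLoop hx hxr⟩
    · obtain ⟨y, hl, hlt⟩ := h.exists_parent x hx hxr
      exact ⟨y, by rw [deleteEdges_isLink]; exact ⟨hl, h.not_isLoop hx hxr⟩, hlt⟩
  exact h'.isTree (hfin.deleteEdges _) (by rw [edgeSet_deleteEdges_isLoop]; exact hcard)

/-- If the removal of the loops leaves a tree, then the edges `t x` are all edges except loops. -/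
lemma exists_isSearchTree_of_isTree [Nonempty β] (hfin : G.IsFinite)
    (hT : (G.deleteEdges {e | G.IsLoop e}).IsTree) :
    ∃ r t ρ, G.IsSearchTree E(G) r t ρ ∧ {d ∈ E(G) | ¬ G.IsLoop d}.ncard + 1 = G.order ∧
      ∀ d ∈ E(G), ¬ G.IsLoop d → ∃ x ∈ V(G), x ≠ r ∧ t x = d := by
  obtain ⟨r, t, ρ, h⟩ := exists_isSearchTree_of_isConnected
    (G := G.deleteEdges {e | G.IsLoop e}) hT.2.connected
  have hN : ∀ x ∈ V(G), x ≠ r → t x ∈ {d ∈ E(G) | ¬ G.IsLoop d} := by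
    rw [← edgeSet_deleteEdges_isLoop]
    exact h.mem
  have h' : G.IsSearchTree E(G) r t ρ := by
    refine ⟨h.root_mem, fun x hx hxr ↦ (hN x hx hxr).1, fun x hx hxr ↦ ?_, h.root_lt⟩
    obtain ⟨y, hl, hlt⟩ := h.exists_parent x hx hxr
    exact ⟨y, hl.mono deleteEdges_le, hlt⟩
  have hfinN : {d ∈ E(G) | ¬ G.IsLoop d}.Finite := hfin.edgeSet_finite.subset fun _ hd ↦ hd.1
  have h1 := hT.ncard_edgeSet_add_one_le (hfin.deleteEdges _)
  rw [edgeSet_deleteEdges_isLoop] at h1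
  refine ⟨r, t, ρ, h', le_antisymm h1 (h'.order_le_ncard hfin hfinN hN), fun d hd hdl ↦ ?_⟩
  have : d ∈ t '' (V(G) \ {r}) := h'.image_eq hfin hfinN hN h1 ▸ ⟨hd, hdl⟩
  obtain ⟨x, hx, rfl⟩ := this
  exact ⟨x, hx.1, hx.2, rfl⟩

end LoopTree

/-! ### Three matchings for the class `𝔐` -/

section ThreeMatchings
variable {α β α' β' : Type*} {G₀ : Graph α β} {ι : β → Bool → α} {k : β → ℕ} {G : Graph α' β'}
  {φ : α → α'} {p : β → ℕ → α'} {q : β → ℕ → β'}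

/-- The edges `t x` can be coloured with three colours. -/
lemma IsSearchTree.exists_coloring {S : Set β} {r : α} {t : α → β} {ρ : α → ℕ}
    (h : G₀.IsSearchTree S r t ρ) (hfin : G₀.IsFinite) (hcubic : G₀.IsCubic)
    (hι : G₀.IsOrientation ι) (s : Finset α) (hs : ∀ x ∈ s, x ∈ V(G₀) ∧ x ≠ r) :
    ∃ γ : β → ℕ, (∀ d, γ d < 3) ∧ ∀ x ∈ s, ∀ x' ∈ s, x ≠ x' → ∀ w, G₀.Inc (t x) w →
      G₀.Inc (t x') w → γ (t x) ≠ γ (t x') := by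
  classical
  induction s using Finset.induction_on_max_value ρ with
  | empty => exact ⟨0, by simp, by simp⟩
  | insert z s hz hmax ih =>
    obtain ⟨γ, hγ, hγ'⟩ := ih fun x hx ↦ hs x (Finset.mem_insert_of_mem hx)
    obtain ⟨hzV, hzr⟩ := hs z (Finset.mem_insert_self _ _)
    obtain ⟨y, hl, hlt⟩ := h.exists_parent z hzV hzr
    obtain ⟨b, hb⟩ := (hι.inc_iff hl.edge_mem).1 hl.inc_right
    have h1 : (t z, b) ∈ halfEdges hfin ι y := by simp [hl.edge_mem, hb]
    -- As `z` has maximal rank, its parent edge meets earlier edges only at the parent `y`, where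
    -- the two other half-edges block at most two of the three colours.
    obtain ⟨a, ha, ha'⟩ : ∃ a ∈ Finset.range 3,
        a ∉ ((halfEdges hfin ι y).erase (t z, b)).image fun u ↦ γ u.1 := by
      apply Finset.exists_mem_notMem_of_card_lt_card
      refine Finset.card_image_le.trans_lt ?_
      rw [Finset.card_erase_of_mem h1, hcubic.card_halfEdges hfin hι hl.right_mem]
      simp
    have hne : ∀ x ∈ s, t x ≠ t z := by
      intro x hx he
      have h2 := hs x (Finset.mem_insert_of_mem hx)
      exact hz (h.injOn ⟨h2.1, h2.2⟩ ⟨hzV, hzr⟩ he ▸ hx)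
    have key : ∀ x ∈ s, ∀ w, G₀.Inc (t x) w → G₀.Inc (t z) w → γ (t x) ≠ a := by
      rintro x hx w hxw hzw rfl
      obtain ⟨hxV, hxr⟩ := hs x (Finset.mem_insert_of_mem hx)
      rcases hzw.eq_or_eq_of_isLink hl with rfl | rfl
      · obtain ⟨x', hl', hlt'⟩ := h.exists_parent x hxV hxr
        rcases hxw.eq_or_eq_of_isLink hl' with rfl | rfl
        · exact hz hx
        · have := hmax x hx
          omega
      · obtain ⟨b', hb'⟩ := (hι.inc_iff hxw.edge_mem).1 hxw
        refine ha' (Finset.mem_image.2 ⟨(t x, b'), Finset.mem_erase.2 ⟨fun he ↦ ?_, ?_⟩, rfl⟩)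
        · exact hne x hx (congrArg Prod.fst he)
        · simp [hxw.edge_mem, hb']
    refine ⟨Function.update γ (t z) a, fun d ↦ ?_, ?_⟩
    · by_cases hd : d = t z
      · rw [hd, Function.update_self]; simpa using ha
      · rw [Function.update_of_ne hd]; exact hγ d
    · intro x hx x' hx' hxx' w hw hw'
      rcases Finset.mem_insert.1 hx with rfl | hxs <;> rcases Finset.mem_insert.1 hx' with rfl | hxs'
      · exact absurd rfl hxx'
      · rw [Function.update_self, Function.update_of_ne (hne x' hxs')]
        exact (key x' hxs' w hw' hw).symm
      · rw [Function.update_self, Function.update_of_ne (hne x hxs)]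
        exact key x hxs w hw hw'
      · rw [Function.update_of_ne (hne x hxs), Function.update_of_ne (hne x' hxs')]
        exact hγ' x hxs x' hxs' hxx' w hw hw'

lemma coloredCount_eq_sum (j m : ℕ) (c : ℕ → ℕ) :
    coloredCount j m c = ∑ i ∈ Finset.range (m + 1), if c i < j then 1 else 0 := by
  rw [coloredCount, Finset.card_filter]

open Classical in
/-- The matching that belongs to the colour `a` of a `3`-edge-colouring `γ` of the loopless part:
on a path of colour `a` the two outer edges, on other paths the middle edge, and on a loop an edge
at its vertex unless that vertex is covered already. -/
noncomputable def classMatching (G₀ : Graph α β) (ι : β → Bool → α) (γ : β → ℕ) (a : ℕ) (d : β)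
    (i : ℕ) : ℕ :=
  if G₀.IsLoop d then
    if i = 0 ∧ ∀ d' ∈ E(G₀), ¬ G₀.IsLoop d' → G₀.Inc d' (ι d false) → γ d' ≠ a then 0 else 1
  else if γ d = a then (if i = 1 then 1 else 0) else if i = 1 then 0 else 1

/-- At a vertex of `G₀`, at most one non-loop has colour `a`, and a loop is used only if there is
none. Two loops cannot share a vertex, as they would need four half-edges. -/
lemma isPathColoring_classMatching (hfin : G₀.IsFinite) (hcubic : G₀.IsCubic)
    (hι : G₀.IsOrientation ι) {γ : β → ℕ}
    (hγ : ∀ d ∈ E(G₀), ∀ d' ∈ E(G₀), ¬ G₀.IsLoop d → ¬ G₀.IsLoop d' → d ≠ d' → ∀ w, G₀.Inc d w →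
      G₀.Inc d' w → γ d ≠ γ d') (a : ℕ) :
    G₀.IsPathColoring ι G₀.loopWeight 1 (G₀.classMatching ι γ a) := by
  classical
  have hloop : ∀ d, G₀.IsLoop d → ∀ b,
      G₀.classMatching ι γ a d (endPos G₀.loopWeight d b) < 1 → b = false ∧
      ∀ d' ∈ E(G₀), ¬ G₀.IsLoop d' → G₀.Inc d' (ι d false) → γ d' ≠ a := by
    intro d hd b hlt
    rw [classMatching, if_pos hd] at hlt
    split_ifs at hlt with h1
    · refine ⟨?_, h1.2⟩
      cases b
      · rfl
      · simp [loopWeight, hd] at h1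
    · omega
  have hnloop : ∀ d, ¬ G₀.IsLoop d → ∀ b,
      G₀.classMatching ι γ a d (endPos G₀.loopWeight d b) < 1 → γ d = a := by
    intro d hd b hlt
    by_contra hne
    rw [classMatching, if_neg hd, if_neg hne] at hlt
    cases b <;> simp [loopWeight, hd] at hlt
  refine ⟨?_, ?_⟩
  · intro d hd i hi hlt he
    rw [he] at hlt
    have hlt' := he ▸ hlt
    by_cases hl : G₀.IsLoop d
    · simp only [classMatching, if_pos hl] at hlt
      rw [if_neg (fun h ↦ by omega)] at hlt
      omega
    · simp only [classMatching, if_neg hl] at hlt hlt'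
      simp only [loopWeight, if_neg hl] at hi
      split_ifs at hlt hlt' <;> omega
  · intro d hd d' hd' b b' hb hlt he
    have hlt' := he ▸ hlt
    by_cases hl : G₀.IsLoop d <;> by_cases hl' : G₀.IsLoop d'
    · obtain ⟨rfl, h1⟩ := hloop d hl b hlt
      obtain ⟨rfl, h2⟩ := hloop d' hl' b' hlt'
      refine ⟨?_, rfl⟩
      by_contra hne
      have h3 := (hι.isLoop_iff hd).1 hl
      have h4 := (hι.isLoop_iff hd').1 hl'
      have h5 := hcubic.eq_of_ne hfin hι (hι.inc hd false).vertex_mem (h₁ := (d, false))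
        (h₂ := (d, true)) (h₃ := (d', false)) (h := (d', true)) (by simp [hd]) (by simp [hd, h3])
        (by simp [hd', hb]) (by simp [hd', hb, h4]) (by simp) (by simp [hne]) (by simp)
      simp [Ne.symm hne] at h5
    · obtain ⟨rfl, h1⟩ := hloop d hl b hlt
      exact absurd (hnloop d' hl' b' hlt') (h1 d' hd' hl' (hb ▸ hι.inc hd' b'))
    · obtain ⟨rfl, h1⟩ := hloop d' hl' b' hlt'
      exact absurd (hnloop d hl b hlt) (h1 d hd hl (hb ▸ hι.inc hd b))
    · have h1 := hnloop d hl b hlt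
      have h2 := hnloop d' hl' b' hlt'
      by_cases hdd : d = d'
      · subst hdd
        refine ⟨rfl, ?_⟩
        rw [hι.isLoop_iff hd] at hl
        cases b <;> cases b' <;> first | rfl | exact absurd hb hl | exact absurd hb.symm hl
      · exact absurd (h1.trans h2.symm) (hγ d hd d' hd' hl hl' hdd _ (hι.inc hd b)
          (hb ▸ hι.inc hd' b'))

lemma IsSubdivisionAlong.six_mul_order_le (h : IsSubdivisionAlong G₀ ι G₀.loopWeight G φ p q)
    (hfin : G₀.IsFinite) (hcubic : G₀.IsCubic)
    (hT : (G₀.deleteEdges {e | G₀.IsLoop e}).IsTree) : 6 * G.order ≤ 13 * G.nu 1 := by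
  classical
  have hV : V(G₀).Nonempty := by
    obtain ⟨⟨x, hx⟩⟩ := hT.2.connected.nonempty
    exact ⟨x, hx⟩
  have hβ := hcubic.nonempty_edge hV
  obtain ⟨r, t, ρ, ht, hcard, hsurj⟩ := exists_isSearchTree_of_isTree hfin hT
  obtain ⟨γ, hγ3, hγ⟩ := ht.exists_coloring hfin hcubic h.orient
    (hfin.vertexSet_finite.toFinset.erase r) (by simp; tauto)
  have hγ' : ∀ d ∈ E(G₀), ∀ d' ∈ E(G₀), ¬ G₀.IsLoop d → ¬ G₀.IsLoop d' → d ≠ d' → ∀ w,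
      G₀.Inc d w → G₀.Inc d' w → γ d ≠ γ d' := by
    intro d hd d' hd' hl hl' hne w hw hw'
    obtain ⟨x, hx, hxr, rfl⟩ := hsurj d hd hl
    obtain ⟨x', hx', hxr', rfl⟩ := hsurj d' hd' hl'
    exact hγ x (by simp [hx, hxr]) x' (by simp [hx', hxr']) (fun he ↦ hne (he ▸ rfl)) w hw hw'
  have hk : ∀ d ∈ E(G₀), 1 ≤ G₀.loopWeight d := by
    intro d _; simp only [loopWeight]; split_ifs <;> omega
  -- Over the three colours a non-loop path contributes `2 + 1 + 1 = 4` edges. A loop contributes in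
  -- the two colours that differ from that of the other edge at its vertex.
  have key : ∀ d ∈ hfin.edgeSet_finite.toFinset, 2 * G₀.loopWeight d ≤
      ∑ a ∈ Finset.range 3, coloredCount 1 (G₀.loopWeight d) (G₀.classMatching ι γ a d) := by
    intro d hd
    rw [Set.Finite.mem_toFinset] at hd
    have h3 := hγ3 d
    by_cases hl : G₀.IsLoop d
    · obtain ⟨u, hu, hu1, hu2⟩ := hcubic.exists_third hfin h.orient
        (h.orient.inc hd false).vertex_mem (d, false) (d, true)
      have h1 : ∀ a, a ≠ γ u.1 → G₀.classMatching ι γ a d 0 < 1 := by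
        intro a ha
        rw [classMatching, if_pos hl, if_pos]
        · exact Nat.one_pos
        · refine ⟨rfl, fun d' hd' hl' hinc ↦ ?_⟩
          obtain ⟨b, hb⟩ := (h.orient.inc_iff hd').1 hinc
          have h5 := hcubic.eq_of_ne hfin h.orient (h.orient.inc hd false).vertex_mem
            (h₁ := (d, false)) (h₂ := (d, true)) (h₃ := u) (h := (d', b)) (by simp [hd])
            (by simp [hd, (h.orient.isLoop_iff hd).1 hl]) hu (by simp [hd', hb]) (by simp)
            hu1.symm hu2.symm
          rcases h5 with h5 | h5 | h5
          · exact absurd hl (congrArg Prod.fst h5 ▸ hl' : ¬ G₀.IsLoop (d, false).1)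
          · exact absurd hl (congrArg Prod.fst h5 ▸ hl' : ¬ G₀.IsLoop (d, true).1)
          · rw [← h5] at ha; exact ha.symm
      have h2 : ∀ a, (if a ≠ γ u.1 then 1 else 0) ≤
          coloredCount 1 (G₀.loopWeight d) (G₀.classMatching ι γ a d) := by
        intro a
        split_ifs with ha
        · rw [coloredCount_eq_sum, Finset.sum_range_succ', if_pos (h1 a ha)]
          omega
        · omega
      have h4 := Finset.sum_le_sum fun a (_ : a ∈ Finset.range 3) ↦ h2 a
      refine le_trans ?_ h4
      have h5 := hγ3 u.1
      simp only [loopWeight, if_pos hl, Finset.sum_range_succ, Finset.sum_range_zero]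
      interval_cases γ u.1 <;> simp
    · simp only [coloredCount_eq_sum, loopWeight, if_neg hl, classMatching, Finset.sum_range_succ,
        Finset.sum_range_zero]
      interval_cases γ d <;> simp
  have h1 := Finset.sum_le_sum key
  rw [Finset.sum_comm, ← Finset.mul_sum, sum_loopWeight hfin] at h1
  have h2 : ∀ a ∈ Finset.range 3, _ ≤ G.nu 1 := fun a _ ↦
    h.sum_coloredCount_le_nu hfin hk (isPathColoring_classMatching hfin hcubic h.orient hγ' a)
  have h3 := h1.trans (Finset.sum_le_sum h2)
  have h4 := h.order_eq hfin
  rw [sum_loopWeight hfin] at h4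
  have h5 := hcubic.three_mul_order hfin h.orient
  rw [Finset.sum_const, Finset.card_range, smul_eq_mul] at h3
  obtain ⟨m, hm⟩ : ∃ m, G₀.order = 2 * m := ⟨G₀.order / 2, by omega⟩
  -- With `n₀ = 2m` one has `n = 7m - 1` and `3ν₁ ≥ 10m - 2`. This suffices for `m ≥ 2`, with no
  -- slack at `m = 2`; for `m = 1` the bound `8/3` must be rounded up to `3`.
  rcases Nat.lt_or_ge m 2 with h6 | h6
  · obtain rfl : m = 1 := by omega
    omega
  · omega

end ThreeMatchings

/-! ### Cutting a loop: edges, vertices and half-edges -/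

section Cut
variable {α β α' β' α'' β'' : Type*} {G₀ : Graph α β} {ι : β → Bool → α} {k : β → ℕ}
  {e f h h' g : β} {u₀ v₀ u v : α}

/-- A loop `e` that can be cut, with the edges `f`, `h`, `h'` directed suitably. -/
structure IsOrientedCut (G₀ : Graph α β) (ι : β → Bool → α) (e f h h' : β) (u₀ v₀ u v : α) : Prop
    extends G₀.IsCuttable e f h h' u₀ v₀ u v where
  fin : G₀.IsFinite
  cubic : G₀.IsCubic
  orient : G₀.IsOrientation ι
  f_false : ι f false = v₀
  f_true : ι f true = u₀
  h_false : ι h false = u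
  h_true : ι h true = v₀
  h'_false : ι h' false = v₀
  h'_true : ι h' true = v

/-- With `h` directed from `u` to `v₀` and `h'` from `v₀` to `v`, the two paths in succession run in
the direction of the new edge from `u` to `v`. -/
lemma IsCuttable.exists_isOrientedCut (hc : G₀.IsCuttable e f h h' u₀ v₀ u v) (hfin : G₀.IsFinite)
    (hcubic : G₀.IsCubic) : ∃ ι, G₀.IsOrientedCut ι e f h h' u₀ v₀ u v := by
  classical
  have : Nonempty α := ⟨u₀⟩
  obtain ⟨ι, hι⟩ := G₀.exists_isOrientation
  refine ⟨fun d b ↦ if d = f then bif b then u₀ else v₀ else if d = h then bif b then v₀ else u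
    else if d = h' then bif b then v else v₀ else ι d b, hc, hfin, hcubic, ?_, ?_, ?_, ?_, ?_, ?_, ?_⟩
  · intro d hd
    dsimp only
    split_ifs with h1 h2 h3
    · rw [h1]; exact hc.link.symm
    · rw [h2]; exact hc.link_h.symm
    · rw [h3]; exact hc.link_h'
    · exact hι d hd
  all_goals simp [hc.h_ne_f, hc.h'_ne_f, hc.h_ne_h'.symm]

lemma mem_edgeSet_addLink {D : Graph α β} {d : β} :
    d ∈ E(D.addLink g u v) ↔ d = g ∨ d ∈ E(D) := by
  rw [edgeSet_eq_setOfPred_exists_isLink]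
  constructor
  · rintro ⟨x, y, ⟨-, hl⟩ | ⟨rfl, -⟩⟩
    exacts [Or.inr hl.edge_mem, Or.inl rfl]
  · intro hd
    by_cases hg : d = g
    · exact ⟨u, v, Or.inr ⟨hg, rfl⟩⟩
    · obtain ⟨x, y, hl⟩ := exists_isLink_of_mem_edgeSet (hd.resolve_left hg)
      exact ⟨x, y, Or.inl ⟨hg, hl⟩⟩

open Classical in
/-- The direction of the edges after the cut. -/
noncomputable def cutOrient (ι : β → Bool → α) (g : β) (u v : α) (d : β) (b : Bool) : α :=
  if d = g then bif b then v else u else ι d b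

open Classical in
/-- The half-edge after the cut that corresponds to a half-edge before. -/
noncomputable def cutHalf (h h' g : β) (y : β × Bool) : β × Bool :=
  if y.1 = h then (g, false) else if y.1 = h' then (g, true) else y

namespace IsOrientedCut

lemma e_end (hc : G₀.IsOrientedCut ι e f h h' u₀ v₀ u v) (b : Bool) : ι e b = u₀ := by
  have := (hc.orient.isLoopAt_iff hc.loop.edge_mem).1 hc.loop
  cases b
  exacts [this.1, this.2]

lemma e_ne_f (hc : G₀.IsOrientedCut ι e f h h' u₀ v₀ u v) : e ≠ f := by
  rintro rfl
  exact hc.ne (by rw [← hc.e_end false, hc.f_false])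

lemma e_ne_h (hc : G₀.IsOrientedCut ι e f h h' u₀ v₀ u v) : e ≠ h := by
  rintro rfl
  exact hc.ne (by rw [← hc.e_end true, hc.h_true])

lemma e_ne_h' (hc : G₀.IsOrientedCut ι e f h h' u₀ v₀ u v) : e ≠ h' := by
  rintro rfl
  exact hc.ne (by rw [← hc.e_end false, hc.h'_false])

/-- The loop fills two of the three half-edges at `u₀`, and `f` the third. -/
lemma eq_of_end_u₀ (hc : G₀.IsOrientedCut ι e f h h' u₀ v₀ u v)
    {d : β} {b : Bool} (hd : d ∈ E(G₀)) (hb : ι d b = u₀) :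
    d = e ∨ d = f ∧ b = true := by
  have := hc.cubic.eq_of_ne hc.fin hc.orient hc.loop.vertex_mem (h₁ := (e, false)) (h₂ := (e, true))
    (h₃ := (f, true)) (h := (d, b)) (by simp [hc.loop.edge_mem, hc.e_end])
    (by simp [hc.loop.edge_mem, hc.e_end]) (by simp [hc.link.edge_mem, hc.f_true])
    (by simp [hd, hb]) (by simp) (by simp) (by simp [hc.e_ne_f])
  simp only [Prod.mk.injEq] at this
  tauto

lemma eq_of_end_v₀ (hc : G₀.IsOrientedCut ι e f h h' u₀ v₀ u v)
    {d : β} {b : Bool} (hd : d ∈ E(G₀)) (hb : ι d b = v₀) :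
    d = f ∧ b = false ∨ d = h ∧ b = true ∨ d = h' ∧ b = false := by
  have := hc.cubic.eq_of_ne hc.fin hc.orient hc.link.right_mem (h₁ := (f, false)) (h₂ := (h, true))
    (h₃ := (h', false)) (h := (d, b)) (by simp [hc.link.edge_mem, hc.f_false])
    (by simp [hc.link_h.edge_mem, hc.h_true]) (by simp [hc.link_h'.edge_mem, hc.h'_false])
    (by simp [hd, hb]) (by simp) (by simp [hc.h'_ne_f.symm]) (by simp)
  simp only [Prod.mk.injEq] at this
  tauto

lemma u_ne_u₀ (hc : G₀.IsOrientedCut ι e f h h' u₀ v₀ u v) : u ≠ u₀ := by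
  intro hu
  rcases hc.eq_of_end_u₀ hc.link_h.edge_mem (hc.h_false.trans hu) with h1 | h1
  · exact hc.e_ne_h h1.symm
  · exact hc.h_ne_f h1.1

lemma v_ne_u₀ (hc : G₀.IsOrientedCut ι e f h h' u₀ v₀ u v) : v ≠ u₀ := by
  intro hu
  rcases hc.eq_of_end_u₀ hc.link_h'.edge_mem (hc.h'_true.trans hu) with h1 | h1
  · exact hc.e_ne_h' h1.symm
  · exact hc.h'_ne_f h1.1

lemma u_ne_v₀ (hc : G₀.IsOrientedCut ι e f h h' u₀ v₀ u v)
    : u ≠ v₀ := fun hu ↦ hc.no_loop h (hu ▸ hc.link_h)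

lemma v_ne_v₀ (hc : G₀.IsOrientedCut ι e f h h' u₀ v₀ u v)
    : v ≠ v₀ := fun hu ↦ hc.no_loop h' (hu ▸ hc.link_h')

lemma mem_edgeSet_iff (hc : G₀.IsOrientedCut ι e f h h' u₀ v₀ u v) {d : β} : d ∈ E(G₀) ↔
    d = e ∨ d = f ∨ d = h ∨ d = h' ∨ d ∈ E(G₀.deleteVerts {u₀, v₀}) := by
  rw [edgeSet_deleteVerts]
  constructor
  · intro hd
    by_contra! hcon
    obtain ⟨h1, h2, h3, h4, h5⟩ := hcon
    refine h5 ⟨_, _, hc.orient d hd, ?_, ?_⟩ <;>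
    · rintro (h6 | h6)
      · rcases hc.eq_of_end_u₀ hd h6 with h | h <;> tauto
      · rcases hc.eq_of_end_v₀ hd h6 with h | h | h <;> tauto
  · rintro (rfl | rfl | rfl | rfl | ⟨x, y, hl, -⟩)
    exacts [hc.loop.edge_mem, hc.link.edge_mem, hc.link_h.edge_mem, hc.link_h'.edge_mem,
      hl.edge_mem]

lemma ne_of_mem (hc : G₀.IsOrientedCut ι e f h h' u₀ v₀ u v)
    {d : β} (hd : d ∈ E(G₀.deleteVerts {u₀, v₀})) :
    d ≠ e ∧ d ≠ f ∧ d ≠ h ∧ d ≠ h' := by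
  rw [edgeSet_deleteVerts] at hd
  obtain ⟨x, y, hl, hx, hy⟩ := hd
  have key : ∀ b, ι d b ∉ ({u₀, v₀} : Set α) := by
    intro b
    rcases (hc.orient.inc hl.edge_mem b).eq_or_eq_of_isLink hl with h1 | h1 <;> rw [h1] <;>
      assumption
  refine ⟨?_, ?_, ?_, ?_⟩ <;> rintro rfl
  · exact key false (by simp [hc.e_end])
  · exact key false (by simp [hc.f_false])
  · exact key true (by simp [hc.h_true])
  · exact key false (by simp [hc.h'_false])

lemma vertexSet_addLink (hc : G₀.IsOrientedCut ι e f h h' u₀ v₀ u v)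
    : V((G₀.deleteVerts {u₀, v₀}).addLink g u v) = V(G₀) \ {u₀, v₀} := by
  change V(G₀.deleteVerts {u₀, v₀}) ∪ {u, v} = _
  rw [vertexSet_deleteVerts, Set.union_eq_left]
  have h1 := hc.u_ne_u₀
  have h2 := hc.u_ne_v₀
  have h3 := hc.v_ne_u₀
  have h4 := hc.v_ne_v₀
  rintro x (rfl | rfl)
  · exact ⟨hc.link_h.right_mem, by simp [h1, h2]⟩
  · exact ⟨hc.link_h'.right_mem, by simp [h3, h4]⟩

lemma finite_addLink (hc : G₀.IsOrientedCut ι e f h h' u₀ v₀ u v)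
    : ((G₀.deleteVerts {u₀, v₀}).addLink g u v).IsFinite := by
  refine ⟨?_, ?_⟩
  · rw [hc.vertexSet_addLink]; exact hc.fin.vertexSet_finite.sdiff
  · refine (hc.fin.edgeSet_finite.insert g).subset fun d hd ↦ ?_
    rcases mem_edgeSet_addLink.1 hd with rfl | hd
    · exact Set.mem_insert _ _
    · exact Set.mem_insert_of_mem _ (hc.mem_edgeSet_iff.2 (by tauto))

lemma order_addLink (hc : G₀.IsOrientedCut ι e f h h' u₀ v₀ u v)
    : G₀.order = ((G₀.deleteVerts {u₀, v₀}).addLink g u v).order + 2 := by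
  rw [order, order, hc.vertexSet_addLink, ← Set.ncard_pair hc.ne,
    Set.ncard_sdiff_add_ncard_of_subset _ hc.fin.vertexSet_finite]
  rintro x (rfl | rfl)
  exacts [hc.loop.vertex_mem, hc.link.right_mem]

open Classical in
lemma exists_sum_eq (hc : G₀.IsOrientedCut ι e f h h' u₀ v₀ u v)
    (hg : g ∉ E(G₀.deleteVerts {u₀, v₀})) : ∃ s : Finset β,
    (∀ d, d ∈ s ↔ d ∈ E(G₀.deleteVerts {u₀, v₀})) ∧
    (∀ F : β → ℕ, ∑ d ∈ hc.fin.edgeSet_finite.toFinset, F d =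
      F e + F f + F h + F h' + ∑ d ∈ s, F d) ∧
    (∀ F : β → ℕ, ∑ d ∈ (hc.finite_addLink (g := g)).edgeSet_finite.toFinset, F d =
      F g + ∑ d ∈ s, F d) := by
  have hfin : E(G₀.deleteVerts {u₀, v₀}).Finite :=
    hc.fin.edgeSet_finite.subset fun d hd ↦ hc.mem_edgeSet_iff.2 (by tauto)
  have hmem : ∀ d, d ∈ hfin.toFinset ↔ d ∈ E(G₀.deleteVerts {u₀, v₀}) := by simp
  refine ⟨hfin.toFinset, hmem, fun F ↦ ?_, fun F ↦ ?_⟩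
  · have h1 : hc.fin.edgeSet_finite.toFinset =
        insert e (insert f (insert h (insert h' hfin.toFinset))) := by
      ext d
      simp only [Set.Finite.mem_toFinset, Finset.mem_insert]
      exact hc.mem_edgeSet_iff
    have h2 : ∀ d, d = e ∨ d = f ∨ d = h ∨ d = h' → d ∉ hfin.toFinset := by
      intro d hd hd'
      obtain ⟨h1, h2, h3, h4⟩ := hc.ne_of_mem ((hmem d).1 hd')
      tauto
    rw [h1, Finset.sum_insert, Finset.sum_insert, Finset.sum_insert, Finset.sum_insert]
    · ring
    · exact h2 _ (by tauto)
    · simp only [Finset.mem_insert, not_or]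
      exact ⟨hc.h_ne_h', h2 _ (by tauto)⟩
    · simp only [Finset.mem_insert, not_or]
      exact ⟨hc.h_ne_f.symm, hc.h'_ne_f.symm, h2 _ (by tauto)⟩
    · simp only [Finset.mem_insert, not_or]
      exact ⟨hc.e_ne_f, hc.e_ne_h, hc.e_ne_h', h2 _ (by tauto)⟩
  · have h1 : (hc.finite_addLink (g := g)).edgeSet_finite.toFinset = insert g hfin.toFinset := by
      ext d
      simp only [Set.Finite.mem_toFinset, Finset.mem_insert]
      exact mem_edgeSet_addLink
    rw [h1, Finset.sum_insert (by rwa [hmem])]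

lemma isOrientation_cutOrient (hc : G₀.IsOrientedCut ι e f h h' u₀ v₀ u v) :
    ((G₀.deleteVerts {u₀, v₀}).addLink g u v).IsOrientation (cutOrient ι g u v) := by
  intro d hd
  by_cases hg : d = g
  · exact Or.inr ⟨hg, by simp [cutOrient, hg]⟩
  · have hd' := (mem_edgeSet_addLink.1 hd).resolve_left hg
    refine Or.inl ⟨hg, ?_⟩
    simp only [cutOrient, if_neg hg]
    have h1 := hd'
    rw [edgeSet_deleteVerts] at h1
    obtain ⟨x, y, hl, hx, hy⟩ := h1
    rw [deleteVerts_isLink]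
    refine ⟨hc.orient d hl.edge_mem, ?_⟩
    rcases hl.eq_and_eq_or_eq_and_eq (hc.orient d hl.edge_mem) with ⟨h1, h2⟩ | ⟨h1, h2⟩ <;>
      rw [← h1, ← h2] <;> exact ⟨by assumption, by assumption⟩

lemma cutHalf_cases (hc : G₀.IsOrientedCut ι e f h h' u₀ v₀ u v)
    {d : β} {b : Bool} (hd : d ∈ E(G₀)) (h1 : ι d b ≠ u₀) (h2 : ι d b ≠ v₀) :
    (d = h ∧ b = false ∧ cutHalf h h' g (d, b) = (g, false)) ∨
    (d = h' ∧ b = true ∧ cutHalf h h' g (d, b) = (g, true)) ∨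
    (d ∈ E(G₀.deleteVerts {u₀, v₀}) ∧ cutHalf h h' g (d, b) = (d, b)) := by
  rcases hc.mem_edgeSet_iff.1 hd with rfl | rfl | rfl | rfl | hd'
  · exact absurd (hc.e_end b) h1
  · cases b
    · exact absurd hc.f_false h2
    · exact absurd hc.f_true h1
  · cases b
    · exact Or.inl ⟨rfl, rfl, by simp [cutHalf]⟩
    · exact absurd hc.h_true h2
  · cases b
    · exact absurd hc.h'_false h2
    · exact Or.inr (Or.inl ⟨rfl, rfl, by simp [cutHalf, hc.h_ne_h'.symm]⟩)
  · obtain ⟨-, -, h3, h4⟩ := hc.ne_of_mem hd'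
    exact Or.inr (Or.inr ⟨hd', by simp [cutHalf, h3, h4]⟩)

lemma cutHalf_end (hc : G₀.IsOrientedCut ι e f h h' u₀ v₀ u v)
    (hg : g ∉ E(G₀.deleteVerts {u₀, v₀})) {d : β} {b : Bool} (hd : d ∈ E(G₀))
    (h1 : ι d b ≠ u₀) (h2 : ι d b ≠ v₀) :
    (cutHalf h h' g (d, b)).1 ∈ E((G₀.deleteVerts {u₀, v₀}).addLink g u v) ∧
    cutOrient ι g u v (cutHalf h h' g (d, b)).1 (cutHalf h h' g (d, b)).2 = ι d b := by
  rcases hc.cutHalf_cases (g := g) hd h1 h2 with ⟨rfl, rfl, h3⟩ | ⟨rfl, rfl, h3⟩ | ⟨hd', h3⟩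
  · rw [h3]
    exact ⟨mem_edgeSet_addLink.2 (Or.inl rfl), by simp [cutOrient, hc.h_false]⟩
  · rw [h3]
    exact ⟨mem_edgeSet_addLink.2 (Or.inl rfl), by simp [cutOrient, hc.h'_true]⟩
  · rw [h3]
    have : d ≠ g := fun he ↦ hg (he ▸ hd')
    exact ⟨mem_edgeSet_addLink.2 (Or.inr hd'), by simp [cutOrient, this]⟩

lemma cutHalf_inj (hc : G₀.IsOrientedCut ι e f h h' u₀ v₀ u v)
    (hg : g ∉ E(G₀.deleteVerts {u₀, v₀})) {d d' : β} {b b' : Bool} (hd : d ∈ E(G₀))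
    (h1 : ι d b ≠ u₀) (h2 : ι d b ≠ v₀) (hd' : d' ∈ E(G₀)) (h1' : ι d' b' ≠ u₀)
    (h2' : ι d' b' ≠ v₀) (he : cutHalf h h' g (d, b) = cutHalf h h' g (d', b')) :
    d = d' ∧ b = b' := by
  rcases hc.cutHalf_cases (g := g) hd h1 h2 with ⟨rfl, rfl, h3⟩ | ⟨rfl, rfl, h3⟩ | ⟨hd1, h3⟩ <;>
  rcases hc.cutHalf_cases (g := g) hd' h1' h2' with ⟨h5, h6, h4⟩ | ⟨h5, h6, h4⟩ | ⟨hd2, h4⟩ <;>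
  rw [h3, h4] at he <;> have he₁ := congrArg Prod.fst he <;> have he₂ := congrArg Prod.snd he <;>
  dsimp only at he₁ he₂ <;>
  first
  | exact ⟨h5.symm, h6.symm⟩
  | exact ⟨he₁, he₂⟩
  | exact absurd he₂ Bool.false_ne_true
  | exact absurd he₂.symm Bool.false_ne_true
  | (rw [he₁] at hd1; exact absurd hd1 hg)
  | (rw [← he₁] at hd2; exact absurd hd2 hg)

/-- At a surviving vertex, `cutHalf` maps the three old half-edges injectively to new ones. A lower
bound on the degree is all that `nu_two_add_order_le` asks for. -/
lemma three_le_card_halfEdges (hc : G₀.IsOrientedCut ι e f h h' u₀ v₀ u v)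
    (hg : g ∉ E(G₀.deleteVerts {u₀, v₀})) {x : α}
    (hx : x ∈ V((G₀.deleteVerts {u₀, v₀}).addLink g u v)) :
    3 ≤ (halfEdges (hc.finite_addLink (g := g)) (cutOrient ι g u v) x).card := by
  rw [hc.vertexSet_addLink] at hx
  obtain ⟨hx, hx'⟩ := hx
  simp only [Set.mem_insert_iff, Set.mem_singleton_iff, not_or] at hx'
  rw [← hc.cubic.card_halfEdges hc.fin hc.orient hx]
  refine Finset.card_le_card_of_injOn (cutHalf h h' g) ?_ ?_
  · rintro ⟨d, b⟩ hy
    obtain ⟨hd, rfl⟩ := mem_halfEdges.1 (Finset.mem_coe.1 hy)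
    exact Finset.mem_coe.2 (mem_halfEdges.2 (hc.cutHalf_end hg hd hx'.1 hx'.2))
  · rintro ⟨d, b⟩ hy ⟨d', b'⟩ hy' he
    obtain ⟨hd, h1⟩ := mem_halfEdges.1 (Finset.mem_coe.1 hy)
    obtain ⟨hd', h2⟩ := mem_halfEdges.1 (Finset.mem_coe.1 hy')
    dsimp only at h1 h2 hd hd'
    obtain ⟨rfl, rfl⟩ := hc.cutHalf_inj hg hd (h1 ▸ hx'.1) (h1 ▸ hx'.2) hd' (h2 ▸ hx'.1)
      (h2 ▸ hx'.2) he
    rfl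

end IsOrientedCut

end Cut

/-! ### Cutting a loop: effect on `ν₁` and `ν₂` -/

section CutMatching
variable {α β α' β' α'' β'' : Type*} {G₀ : Graph α β} {ι : β → Bool → α} {k : β → ℕ}
  {e f h h' g : β} {u₀ v₀ u v : α}

open Classical in
/-- The matching before the cut that belongs to a matching `c` after the cut. -/
noncomputable def uncutMatching (k : β → ℕ) (e f h h' g : β) (c : β → ℕ → ℕ) (d : β) (i : ℕ) : ℕ :=
  -- The path for `e` uses its first but not its last edge, so `u₀` is covered once; the path for
  -- `f` uses neither end edge.
  if d = e then if i % 2 = 0 ∧ i < k e then 0 else 1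
  else if d = f then if i % 2 = 1 ∧ i < k f then 0 else 1
  -- The path for `g` has three edges fewer than those for `h` and `h'` together. It is cut at its
  -- edge `k h`, which is copied to the last edge of `h` and to edge `2` of `h'`. Of the edges
  -- between the copies, edge `0` of `h'` stays free, and edge `1` is used exactly when the copied
  -- edge is not.
  else if d = h then c g i
  else if d = h' then
    if i = 0 then 1 else if i = 1 then if c g (k h) < 1 then 1 else 0 else c g (i + k h - 2)
  else c d i

lemma half_le_coloredCount {m r s : ℕ} {c : ℕ → ℕ} (hc : ∀ i < s, i % 2 = r → c i < 1)
    (hs : s ≤ m + 1) (hr : r < 2) : (s + 1 - r) / 2 ≤ coloredCount 1 m c := by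
  have h1 : ((Finset.range ((s + 1 - r) / 2)).image fun i ↦ 2 * i + r).card = (s + 1 - r) / 2 := by
    rw [Finset.card_image_of_injective _ (fun a b hab ↦ by omega),
      Finset.card_range]
  rw [← h1, coloredCount]
  refine Finset.card_le_card fun i hi ↦ ?_
  simp only [Finset.mem_image, Finset.mem_range] at hi
  obtain ⟨j, hj, rfl⟩ := hi
  rw [Finset.mem_filter, Finset.mem_range]
  exact ⟨by omega, hc _ (by omega) (by omega)⟩

namespace IsOrientedCut

lemma uncutMatching_e (c : β → ℕ → ℕ) (i : ℕ) :
    uncutMatching k e f h h' g c e i = if i % 2 = 0 ∧ i < k e then 0 else 1 := by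
  simp [uncutMatching]

lemma uncutMatching_f (hc : G₀.IsOrientedCut ι e f h h' u₀ v₀ u v) (c : β → ℕ → ℕ) (i : ℕ) :
    uncutMatching k e f h h' g c f i = if i % 2 = 1 ∧ i < k f then 0 else 1 := by
  simp [uncutMatching, hc.e_ne_f.symm]

lemma uncutMatching_h (hc : G₀.IsOrientedCut ι e f h h' u₀ v₀ u v) (c : β → ℕ → ℕ) (i : ℕ) :
    uncutMatching k e f h h' g c h i = c g i := by
  simp [uncutMatching, hc.e_ne_h.symm, hc.h_ne_f]

lemma uncutMatching_h' (hc : G₀.IsOrientedCut ι e f h h' u₀ v₀ u v) (c : β → ℕ → ℕ) (i : ℕ) :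
    uncutMatching k e f h h' g c h' i = if i = 0 then 1 else if i = 1 then
      if c g (k h) < 1 then 1 else 0 else c g (i + k h - 2) := by
  simp only [uncutMatching, if_neg hc.e_ne_h'.symm, if_neg hc.h'_ne_f, if_neg hc.h_ne_h'.symm,
    if_true]

lemma uncutMatching_of_mem (hc : G₀.IsOrientedCut ι e f h h' u₀ v₀ u v) (c : β → ℕ → ℕ) {d : β}
    (hd : d ∈ E(G₀.deleteVerts {u₀, v₀})) (i : ℕ) :
    uncutMatching k e f h h' g c d i = c d i := by
  obtain ⟨h1, h2, h3, h4⟩ := hc.ne_of_mem hd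
  simp [uncutMatching, h1, h2, h3, h4]

lemma isPathColoring_uncutMatching (hc : G₀.IsOrientedCut ι e f h h' u₀ v₀ u v)
    (hg : g ∉ E(G₀.deleteVerts {u₀, v₀})) (hkh : 2 ≤ k h) (hkh' : 2 ≤ k h')
    (hke : 1 ≤ k e) {c : β → ℕ → ℕ}
    (hcol : ((G₀.deleteVerts {u₀, v₀}).addLink g u v).IsPathColoring (cutOrient ι g u v)
      (cutWeight k h h' g) 1 c) :
    G₀.IsPathColoring ι k 1 (uncutMatching k e f h h' g c) := by
  have hkg : cutWeight k h h' g g = k h + k h' - 2 := by simp [cutWeight]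
  have hkd : ∀ d ∈ E(G₀.deleteVerts {u₀, v₀}), cutWeight k h h' g d = k d := by
    intro d hd
    simp [cutWeight, show d ≠ g from fun he ↦ hg (he ▸ hd)]
  have hgE : g ∈ E((G₀.deleteVerts {u₀, v₀}).addLink g u v) := mem_edgeSet_addLink.2 (Or.inl rfl)
  have hgsucc := hcol.succ_ne g hgE
  rw [hkg] at hgsucc
  refine ⟨?_, ?_⟩
  · intro d hd i hi hlt
    rcases hc.mem_edgeSet_iff.1 hd with rfl | rfl | rfl | rfl | hd'
    · rw [uncutMatching_e] at hlt ⊢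
      rw [uncutMatching_e]
      split_ifs at hlt ⊢ <;> omega
    · rw [hc.uncutMatching_f] at hlt ⊢
      rw [hc.uncutMatching_f]
      split_ifs at hlt ⊢ <;> omega
    · rw [hc.uncutMatching_h] at hlt ⊢
      rw [hc.uncutMatching_h]
      exact hgsucc i (by omega) hlt
    · rw [hc.uncutMatching_h'] at hlt ⊢
      rw [hc.uncutMatching_h']
      rcases i with _ | _ | i
      · simp at hlt
      · simp only [show 0 + 1 + 1 + k h - 2 = k h by omega] at hlt ⊢
        split_ifs at hlt ⊢ <;> omega
      · have := hgsucc (i + k h) (by omega)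
        simp only [show i + 1 + 1 + k h - 2 = i + k h by omega,
          show i + 1 + 1 + 1 + k h - 2 = i + k h + 1 by omega] at hlt ⊢
        split_ifs at hlt ⊢ <;> omega
    · rw [hc.uncutMatching_of_mem c hd'] at hlt ⊢
      rw [hc.uncutMatching_of_mem c hd']
      exact hcol.succ_ne d (mem_edgeSet_addLink.2 (Or.inr hd')) i (by rwa [hkd d hd']) hlt
  -- At `u₀` only the first edge of `e` can be used, at `v₀` only the last edge of `h`; elsewhere
  -- the end edges are those of the matching after the cut.
  · have hu₀ : ∀ d ∈ E(G₀), ∀ b, ι d b = u₀ →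
        uncutMatching k e f h h' g c d (endPos k d b) < 1 → d = e ∧ b = false := by
      intro d hd b hb hlt
      rcases hc.eq_of_end_u₀ hd hb with rfl | ⟨rfl, rfl⟩
      · refine ⟨rfl, ?_⟩
        cases b
        · rfl
        · rw [uncutMatching_e, endPos_true] at hlt
          simp at hlt
      · rw [hc.uncutMatching_f, endPos_true] at hlt
        simp at hlt
    have hv₀ : ∀ d ∈ E(G₀), ∀ b, ι d b = v₀ →
        uncutMatching k e f h h' g c d (endPos k d b) < 1 → d = h ∧ b = true := by
      intro d hd b hb hlt
      rcases hc.eq_of_end_v₀ hd hb with ⟨rfl, rfl⟩ | h1 | ⟨rfl, rfl⟩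
      · rw [hc.uncutMatching_f, endPos_false] at hlt
        simp at hlt
      · exact h1
      · rw [hc.uncutMatching_h', endPos_false] at hlt
        simp at hlt
    have hother : ∀ d ∈ E(G₀), ∀ b, ι d b ≠ u₀ → ι d b ≠ v₀ →
        uncutMatching k e f h h' g c d (endPos k d b) = c (cutHalf h h' g (d, b)).1
          (endPos (cutWeight k h h' g) (cutHalf h h' g (d, b)).1 (cutHalf h h' g (d, b)).2) := by
      intro d hd b h1 h2
      rcases hc.cutHalf_cases (g := g) hd h1 h2 with ⟨rfl, rfl, h3⟩ | ⟨rfl, rfl, h3⟩ | ⟨hd', h3⟩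
      · rw [h3, hc.uncutMatching_h, endPos_false, endPos_false]
      · rw [h3, hc.uncutMatching_h', endPos_true, endPos_true, hkg, if_neg (by omega),
          if_neg (by omega), add_comm (k h)]
      · rw [h3, hc.uncutMatching_of_mem c hd']
        congr 1
        cases b
        · rfl
        · exact (hkd d hd').symm
    intro d hd d' hd' b b' hb hlt he
    have hlt' := he ▸ hlt
    by_cases h1 : ι d b = u₀
    · obtain ⟨rfl, rfl⟩ := hu₀ d hd b h1 hlt
      obtain ⟨rfl, rfl⟩ := hu₀ d' hd' b' (hb ▸ h1) hlt'
      exact ⟨rfl, rfl⟩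
    by_cases h2 : ι d b = v₀
    · obtain ⟨rfl, rfl⟩ := hv₀ d hd b h2 hlt
      obtain ⟨rfl, rfl⟩ := hv₀ d' hd' b' (hb ▸ h2) hlt'
      exact ⟨rfl, rfl⟩
    have h1' : ι d' b' ≠ u₀ := hb ▸ h1
    have h2' : ι d' b' ≠ v₀ := hb ▸ h2
    rw [hother d hd b h1 h2] at hlt he
    rw [hother d' hd' b' h1' h2'] at he
    obtain ⟨h3, h4⟩ := hc.cutHalf_end hg hd h1 h2
    obtain ⟨h5, h6⟩ := hc.cutHalf_end hg hd' h1' h2'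
    obtain ⟨h7, h8⟩ := hcol.end_ne _ h3 _ h5 _ _ (h4.trans (hb.trans h6.symm)) hlt he
    exact hc.cutHalf_inj hg hd h1 h2 hd' h1' h2' (Prod.ext h7 h8)

/-- The gain is always one edge: the second copy of edge `k h` of `g` if that edge is used, and edge
`1` of `h'` otherwise. -/
lemma coloredCount_uncutMatching (hc : G₀.IsOrientedCut ι e f h h' u₀ v₀ u v) (hkh' : 2 ≤ k h')
    (c : β → ℕ → ℕ) :
    coloredCount 1 (cutWeight k h h' g g) (c g) + 1 =
      coloredCount 1 (k h) (uncutMatching k e f h h' g c h) +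
      coloredCount 1 (k h') (uncutMatching k e f h h' g c h') := by
  obtain ⟨s, hs⟩ : ∃ s, k h' = s + 2 := ⟨k h' - 2, by omega⟩
  have hkg : cutWeight k h h' g g + 1 = k h + (s + 1) := by simp [cutWeight]; omega
  simp only [coloredCount_eq_sum, hkg, hs]
  rw [Finset.sum_range_add, Finset.sum_range_succ (n := k h), Finset.sum_range_succ' (n := s + 2),
    Finset.sum_range_succ' (n := s + 1)]
  simp only [hc.uncutMatching_h, hc.uncutMatching_h']
  have h1 : ∀ i, i + 1 + 1 + k h - 2 = k h + i := by omega
  simp only [h1]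
  simp
  split_ifs <;> simp_all <;> omega

end IsOrientedCut

/-- The effect of cutting a loop on the parameters of the subdivisions. -/
lemma IsLoopCut.parameters {G₀ G₀' : Graph α β} {k k' : β → ℕ} {G : Graph α' β'} {G' : Graph α'' β''}
    (hcut : G₀.IsLoopCut k e f G₀' k') (hfin : G₀.IsFinite) (hconn : G₀.IsConnected)
    (hcubic : G₀.IsCubic) (hk : ∀ d ∈ E(G₀), 1 ≤ k d)
    (hk₂ : ∀ d ∈ E(G₀), ¬ G₀.IsLoop d → 2 ≤ k d) (hG : G₀.IsSubdivision k G)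
    (hG' : G₀'.IsSubdivision k' G') :
    G₀.order = G₀'.order + 2 ∧ G.order = G'.order + k f + k e + 4 ∧
      G.nu 1 ≥ G'.nu 1 + k f / 2 + (k e + 1) / 2 + 1 ∧ G.nu 2 ≥ G'.nu 2 + k f + k e + 3 := by
  classical
  obtain ⟨h, h', g, u₀, v₀, u, v, hc, hg, rfl, rfl⟩ := hcut
  obtain ⟨ι, hc⟩ := hc.exists_isOrientedCut hfin hcubic
  obtain ⟨φ, p, q, hG⟩ := hG
  obtain ⟨p, q, hG⟩ := hG.exists_along hc.orient
  obtain ⟨φ', p', q', hG'⟩ := hG'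
  obtain ⟨p', q', hG'⟩ := hG'.exists_along hc.isOrientation_cutOrient
  have hnl : ∀ d ∈ E(G₀), ∀ b, ι d b = v₀ → 2 ≤ k d := by
    intro d hd b hb
    refine hk₂ d hd ?_
    rintro ⟨x, hx⟩
    refine hc.no_loop d ?_
    have := (hc.orient.isLoopAt_iff hd).1 hx
    cases b
    · rwa [← hb, this.1]
    · rwa [← hb, this.2]
  have hkh := hnl h hc.link_h.edge_mem true hc.h_true
  have hkh' := hnl h' hc.link_h'.edge_mem false hc.h'_false
  have hke := hk e hc.loop.edge_mem
  have hkf := hk f hc.link.edge_mem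
  have hord := hc.order_addLink (g := g)
  obtain ⟨s, hs, hsum, hsum'⟩ := hc.exists_sum_eq hg
  have hne : ∀ d ∈ s, d ≠ g := fun d hd he ↦ hg (he ▸ (hs d).1 hd)
  have hk' : ∀ d ∈ E((G₀.deleteVerts {u₀, v₀}).addLink g u v), 1 ≤ cutWeight k h h' g d := by
    intro d hd
    by_cases hdg : d = g
    · simp [cutWeight, hdg]; omega
    · simp only [cutWeight, if_neg hdg]
      exact hk d (hc.mem_edgeSet_iff.2 (by have := mem_edgeSet_addLink.1 hd; tauto))
  have hkg : cutWeight k h h' g g = k h + k h' - 2 := by simp [cutWeight]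
  have hsk : ∑ d ∈ s, cutWeight k h h' g d = ∑ d ∈ s, k d :=
    Finset.sum_congr rfl fun d hd ↦ by simp [cutWeight, hne d hd]
  have horder := hG.order_eq hc.fin
  have horder' := hG'.order_eq hc.finite_addLink
  rw [hsum] at horder
  rw [hsum', hkg, hsk] at horder'
  have hn : G.order = G'.order + k f + k e + 4 := by omega
  refine ⟨hord, hn, ?_, ?_⟩
  · obtain ⟨c, hcol, hcsum⟩ := hG'.exists_sum_coloredCount_eq_nu hc.finite_addLink hk' 1
    have h1 := hG.sum_coloredCount_le_nu hc.fin hk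
      (hc.isPathColoring_uncutMatching hg hkh hkh' hke hcol)
    rw [hsum] at h1
    rw [hsum'] at hcsum
    have h2 := hc.coloredCount_uncutMatching (g := g) hkh' c
    have h3 : ∑ d ∈ s, coloredCount 1 (k d) (uncutMatching k e f h h' g c d) =
        ∑ d ∈ s, coloredCount 1 (cutWeight k h h' g d) (c d) := by
      refine Finset.sum_congr rfl fun d hd ↦ ?_
      rw [funext (hc.uncutMatching_of_mem c ((hs d).1 hd))]
      simp [cutWeight, hne d hd]
    have h4 := half_le_coloredCount (m := k e) (r := 0) (s := k e)
      (c := uncutMatching k e f h h' g c e) (fun i hi hi' ↦ by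
        rw [IsOrientedCut.uncutMatching_e, if_pos ⟨hi', hi⟩]; exact Nat.one_pos) (by omega) (by omega)
    have h5 := half_le_coloredCount (m := k f) (r := 1) (s := k f)
      (c := uncutMatching k e f h h' g c f) (fun i hi hi' ↦ by
        rw [hc.uncutMatching_f, if_pos ⟨hi', hi⟩]; exact Nat.one_pos) (by omega) (by omega)
    simp only [Nat.sub_zero, Nat.add_sub_cancel] at h4 h5
    omega
  -- No matchings are transferred here: the upper bound for `ν₂'` and the lower bound for `ν₂`
  -- differ by exactly the claimed amount.
  · have h1 := hG'.nu_two_add_order_le hc.finite_addLink hk'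
      fun x hx ↦ hc.three_le_card_halfEdges hg hx
    have h2 := hG.two_mul_order_le hc.fin hconn hcubic hk
    have h3 := hcubic.three_mul_order hc.fin hc.orient
    rw [Finset.card_eq_sum_ones, hsum] at h3
    rw [hsum', Finset.sum_add_distrib, hsk, hkg] at h1
    omega

end CutMatching

/-! ### Bounds on the order, and two adjacent loops -/

section Bounds
variable {α β α' β' : Type*} {G₀ : Graph α β} {k : β → ℕ} {G : Graph α' β'} {e f g : β}

lemma loopWeight_le (hk : ∀ d ∈ E(G₀), 1 ≤ k d) (hk₂ : ∀ d ∈ E(G₀), ¬ G₀.IsLoop d → 2 ≤ k d) {d : β}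
    (hd : d ∈ E(G₀)) : G₀.loopWeight d ≤ k d := by
  by_cases h : G₀.IsLoop d
  · simpa [loopWeight, h] using hk d hd
  · simpa [loopWeight, h] using hk₂ d hd h

/-- The least weights sum to `3n₀/2` plus the number of non-loops, and a spanning tree provides `n₀
- 1` of the latter. -/
lemma IsCubic.seven_mul_order_le (hcubic : G₀.IsCubic) (hfin : G₀.IsFinite)
    (hconn : G₀.IsConnected) :
    7 * G₀.order ≤ 2 * (G₀.order + ∑ d ∈ hfin.edgeSet_finite.toFinset, G₀.loopWeight d) + 2 := by
  have hβ := hcubic.nonempty_edge hconn.nonempty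
  have : Nonempty α := ⟨hconn.nonempty.choose⟩
  obtain ⟨ι, hι⟩ := G₀.exists_isOrientation
  have h1 := hcubic.three_mul_order hfin hι
  have h2 := hconn.order_le hfin
  rw [sum_loopWeight hfin]
  omega

lemma seven_mul_order_le_of_ne (hcubic : G₀.IsCubic) (hfin : G₀.IsFinite) (hconn : G₀.IsConnected)
    (hk : ∀ d ∈ E(G₀), 1 ≤ k d) (hk₂ : ∀ d ∈ E(G₀), ¬ G₀.IsLoop d → 2 ≤ k d)
    (hex : ∃ d ∈ E(G₀), k d ≠ G₀.loopWeight d) :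
    7 * G₀.order ≤ 2 * (G₀.order + ∑ d ∈ hfin.edgeSet_finite.toFinset, k d) := by
  have h1 := hcubic.seven_mul_order_le hfin hconn
  obtain ⟨d, hd, hne⟩ := hex
  have h2 : ∑ d ∈ hfin.edgeSet_finite.toFinset, G₀.loopWeight d <
      ∑ d ∈ hfin.edgeSet_finite.toFinset, k d :=
    Finset.sum_lt_sum (fun d hd ↦ loopWeight_le hk hk₂ (by simpa using hd))
      ⟨d, by simpa using hd, lt_of_le_of_ne (loopWeight_le hk hk₂ hd) hne.symm⟩
  omega

/-- Each loop together with `f` exhausts the three half-edges at its vertex, so no edge leaves these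
two vertices; connectedness does the rest. -/
lemma isTrivialCubic_of_edgeAdj (hcubic : G₀.IsCubic) (hfin : G₀.IsFinite)
    (hconn : G₀.IsConnected) (hf : f ∈ E(G₀)) (he : G₀.IsLoop e) (hg : G₀.IsLoop g)
    (hne : e ≠ g) (hfe : G₀.EdgeAdj f e) (hfg : G₀.EdgeAdj f g) : G₀.IsTrivialCubic e f g := by
  classical
  have : Nonempty α := ⟨hconn.nonempty.choose⟩
  obtain ⟨ι, hι⟩ := G₀.exists_isOrientation
  obtain ⟨x, hex⟩ := he
  obtain ⟨y, hgy⟩ := hg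
  obtain ⟨hfe, x', hfx, hex'⟩ := hfe
  obtain rfl := hex.eq_of_inc hex'
  obtain ⟨hfg, y', hfy, hgy'⟩ := hfg
  obtain rfl := hgy.eq_of_inc hgy'
  obtain ⟨he1, he2⟩ := (hι.isLoopAt_iff hex.edge_mem).1 hex
  obtain ⟨hg1, hg2⟩ := (hι.isLoopAt_iff hgy.edge_mem).1 hgy
  obtain ⟨b, hb⟩ := (hι.inc_iff hf).1 hfx
  obtain ⟨b', hb'⟩ := (hι.inc_iff hf).1 hfy
  have hX : ∀ d ∈ E(G₀), ∀ i, ι d i = x → d = e ∨ (d, i) = (f, b) := by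
    intro d hd i hdi
    have := hcubic.eq_of_ne hfin hι hex.vertex_mem (h₁ := (e, false)) (h₂ := (e, true))
      (h₃ := (f, b)) (h := (d, i)) (by simp [hex.edge_mem, he1]) (by simp [hex.edge_mem, he2])
      (by simp [hf, hb]) (by simp [hd, hdi]) (by simp) (by simp [hfe.symm]) (by simp [hfe.symm])
    simp only [Prod.mk.injEq] at this ⊢
    tauto
  have hY : ∀ d ∈ E(G₀), ∀ i, ι d i = y → d = g ∨ (d, i) = (f, b') := by
    intro d hd i hdi
    have := hcubic.eq_of_ne hfin hι hgy.vertex_mem (h₁ := (g, false)) (h₂ := (g, true))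
      (h₃ := (f, b')) (h := (d, i)) (by simp [hgy.edge_mem, hg1]) (by simp [hgy.edge_mem, hg2])
      (by simp [hf, hb']) (by simp [hd, hdi]) (by simp) (by simp [hfg.symm]) (by simp [hfg.symm])
    simp only [Prod.mk.injEq] at this ⊢
    tauto
  have hxy : x ≠ y := by
    rintro rfl
    rcases hY e hex.edge_mem false he1 with h | h
    · exact hne h
    · exact hfe (congrArg Prod.fst h).symm
  have hlink : G₀.IsLink f x y := by
    have hbb : b ≠ b' := by rintro rfl; exact hxy (hb.symm.trans hb')
    have := hι f hf
    cases b <;> cases b' <;> first | exact absurd rfl hbb | (rw [← hb, ← hb']; exact this) |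
      (rw [← hb, ← hb']; exact this.symm)
  have hclosed : ∀ d w z, G₀.IsLink d w z → (w = x ∨ w = y) → (z = x ∨ z = y) := by
    intro d w z hl hw
    obtain ⟨i, hi⟩ := (hι.inc_iff hl.edge_mem).1 hl.inc_left
    rcases hw with rfl | rfl
    · rcases hX d hl.edge_mem i hi with rfl | h
      · rcases hl.eq_and_eq_or_eq_and_eq hex with ⟨-, h⟩ | ⟨-, h⟩ <;> exact Or.inl h
      · obtain rfl : d = f := congrArg Prod.fst h
        rcases hl.eq_and_eq_or_eq_and_eq hlink with ⟨-, h⟩ | ⟨-, h⟩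
        exacts [Or.inr h, Or.inl h]
    · rcases hY d hl.edge_mem i hi with rfl | h
      · rcases hl.eq_and_eq_or_eq_and_eq hgy with ⟨-, h⟩ | ⟨-, h⟩ <;> exact Or.inr h
      · obtain rfl : d = f := congrArg Prod.fst h
        rcases hl.eq_and_eq_or_eq_and_eq hlink with ⟨-, h⟩ | ⟨-, h⟩
        exacts [Or.inr h, Or.inl h]
  have hV : ∀ w ∈ V(G₀), w = x ∨ w = y := by
    intro w hw
    obtain ⟨p⟩ := hconn.reachable hex.vertex_mem hw
    have key : ∀ {a c : α}, (G₀.linkGraph E(G₀)).Walk a c → (a = x ∨ a = y) → (c = x ∨ c = y) := by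
      intro a c p
      induction p with
      | nil => exact id
      | cons hadj p ih =>
        obtain ⟨-, d, -, hl⟩ := hadj
        exact fun ha ↦ ih (hclosed d _ _ hl ha)
    exact key p (Or.inl rfl)
  refine ⟨hfe.symm, hne, hfg, ?_, x, y, hxy, ?_, hex, hlink, hgy⟩
  · ext d
    constructor
    · intro hd
      rcases hV _ (hι.inc hd false).vertex_mem with h | h
      · rcases hX d hd false h with h | h
        · exact Or.inl h
        · exact Or.inr (Or.inl (congrArg Prod.fst h))
      · rcases hY d hd false h with h | h
        · exact Or.inr (Or.inr h)
        · exact Or.inr (Or.inl (congrArg Prod.fst h))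
    · rintro (rfl | rfl | rfl)
      exacts [hex.edge_mem, hf, hgy.edge_mem]
  · ext w
    constructor
    · exact hV w
    · rintro (rfl | rfl)
      exacts [hex.vertex_mem, hgy.vertex_mem]

lemma InClassM.six_mul_order_le {α β : Type u} {G : Graph α β} (h : G.InClassM) :
    6 * G.order ≤ 13 * G.nu 1 := by
  obtain ⟨γ, δ, T₀, hfin, hcubic, hT, φ, p, q, hG⟩ := h
  have : Nonempty γ := ⟨hT.2.connected.nonempty.some⟩
  obtain ⟨ι, hι⟩ := T₀.exists_isOrientation
  obtain ⟨p, q, hG⟩ := hG.exists_along hι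
  exact hG.six_mul_order_le hfin hcubic hT

end Bounds
end Graph

/-! ### Deduction of the estimates -/

/-- `n₀ = G₀.order`, `n = G.order`, `ν_i = nu i G`; the primed quantities belong to the
pseudo-graph `G₀'` obtained by cutting a loop, and to its subdivision `G'`. -/
theorem mainTheorem4 {α β α' β' : Type u}
    (G₀ : Graph α β) (k : β → ℕ) (G : Graph α' β')
    (hfin : G₀.IsFinite) (hconn : G₀.IsConnected) (hcubic : G₀.IsCubic)
    (hk : ∀ d ∈ G₀.edgeSet, 1 ≤ k d)
    (hk₂ : ∀ d ∈ G₀.edgeSet, ¬ G₀.IsLoop d → 2 ≤ k d)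
    (hG : G₀.IsSubdivision k G) :
    -- (a)
    (G₀.Loopless →
      (G.nu 2 : ℚ) ≥ 7 / 8 * G.order ∧ G.order ≥ 4 * G₀.order) ∧
    -- (b)
    (∀ e f g, f ∈ G₀.edgeSet → G₀.IsLoop e → G₀.IsLoop g → e ≠ g →
      G₀.EdgeAdj f e → G₀.EdgeAdj f g →
      G₀.IsTrivialCubic e f g ∧
      (G.nu 2 : ℚ) / G.order = ((k e + k f + k g + 1 : ℕ) : ℚ) / (k e + k f + k g + 2 : ℕ)) ∧
    -- (c)
    (∀ (e f : β) (G₀' : Graph α β) (k' : β → ℕ), G₀.IsLoopCut k e f G₀' k' →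
      ∀ (α'' β'' : Type u) (G' : Graph α'' β''), G₀'.IsSubdivision k' G' →
        G₀.order = G₀'.order + 2 ∧
        G.order = G'.order + k f + k e + 4 ∧
        G.nu 1 ≥ G'.nu 1 + k f / 2 + (k e + 1) / 2 + 1 ∧
        G.nu 2 ≥ G'.nu 2 + k f + k e + 3) ∧
    -- (d)
    ((G.nu 2 : ℚ) ≥ 5 / 6 * G.order ∧ G.order ≥ 3 * G₀.order) ∧
    -- (e)
    ((∃ e ∈ G₀.edgeSet, G₀.IsLoop e ∧ 2 ≤ k e) →
      (G.nu 2 : ℚ) ≥ 6 / 7 * G.order ∧ (G.order : ℚ) ≥ 7 / 2 * G₀.order) ∧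
    ((∃ f ∈ G₀.edgeSet, ¬ G₀.IsLoop f ∧ 3 ≤ k f) →
      (G.nu 2 : ℚ) ≥ 6 / 7 * G.order ∧ (G.order : ℚ) ≥ 7 / 2 * G₀.order) ∧
    -- (f)
    ((G.nu 1 : ℚ) ≥ 3 / 7 * G.order) ∧
    -- (g)
    (G.InClassM → (G.nu 1 : ℚ) ≥ 6 / 13 * G.order) ∧
    -- (h)
    (∀ (e f : β) (G₀' : Graph α β) (k' : β → ℕ), G₀.IsLoopCut k e f G₀' k' →
      ∀ (α'' β'' : Type u) (G' : Graph α'' β''), G₀'.IsSubdivision k' G' →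
        (G'.order : ℚ) ≥ 7 / 2 * G₀'.order → (G.order : ℚ) ≥ 7 / 2 * G₀.order) ∧
    -- (i)
    ((G.order : ℚ) < 7 / 2 * G₀.order → G.InClassM) := by
  have hV := hconn.nonempty
  have : Nonempty α := ⟨hV.choose⟩
  have hβ := hcubic.nonempty_edge hV
  obtain ⟨ι, hι⟩ := G₀.exists_isOrientation
  have hG' := hG
  obtain ⟨φ, p, q, hG'⟩ := hG'
  obtain ⟨p, q, hG'⟩ := hG'.exists_along hι
  have hn := hG'.order_eq hfin
  have hE := hcubic.three_mul_order hfin hι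
  have hnu := hG'.two_mul_order_eq hfin hconn hcubic hk
  have hnu' := hG'.nu_two_le hfin hk
  have hmin := hcubic.seven_mul_order_le hfin hconn
  have hpos : 0 < G₀.order := (Set.ncard_pos hfin.vertexSet_finite).2 hV
  have hle : ∑ d ∈ hfin.edgeSet_finite.toFinset, G₀.loopWeight d ≤
      ∑ d ∈ hfin.edgeSet_finite.toFinset, k d :=
    Finset.sum_le_sum fun d hd ↦ Graph.loopWeight_le hk hk₂ (by simpa using hd)
  have hbig : (∃ d ∈ G₀.edgeSet, k d ≠ G₀.loopWeight d) → 7 * G₀.order ≤ 2 * G.order := fun h ↦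
    hn ▸ Graph.seven_mul_order_le_of_ne hcubic hfin hconn hk hk₂ h
  have hclass : 2 * G.order < 7 * G₀.order → G.InClassM := by
    intro hlt
    have heq : ∀ d ∈ G₀.edgeSet, k d = G₀.loopWeight d := by
      by_contra! hcon
      have := hbig hcon
      omega
    refine ⟨α, β, G₀, hfin, hcubic, Graph.isTree_deleteEdges_isLoop hconn hfin ?_, hG.congr heq⟩
    -- Below `7n₀/2` there is room for at most `n₀ - 1` non-loops, so they form a tree.
    rw [Graph.sum_loopWeight hfin] at hle
    omega
  have he : 7 * G₀.order ≤ 2 * G.order →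
      (G.nu 2 : ℚ) ≥ 6 / 7 * G.order ∧ (G.order : ℚ) ≥ 7 / 2 * G₀.order := by
    intro h
    have h1 : 6 * G.order ≤ 7 * G.nu 2 := by omega
    have h2 : (7 * G₀.order : ℚ) ≤ 2 * G.order := by exact_mod_cast h
    have h3 : (6 * G.order : ℚ) ≤ 7 * G.nu 2 := by exact_mod_cast h1
    constructor <;> linarith
  refine ⟨fun hloop ↦ ?_, fun e f g hf hle hlg hne hfe hfg ↦ ?_,
    fun e f G₀' k' hcut α'' β'' G' hG' ↦ hcut.parameters hfin hconn hcubic hk hk₂ hG hG',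
    ⟨?_, by omega⟩, ?_, ?_, ?_, fun hM ↦ ?_, fun e f G₀' k' hcut α'' β'' G' hG' h ↦ ?_, fun h ↦ ?_⟩
  · have h1 : {d ∈ G₀.edgeSet | ¬ G₀.IsLoop d} = G₀.edgeSet :=
      Set.sep_eq_self_iff_mem_true.2 fun d _ ⟨x, hx⟩ ↦ hloop.not_isLoopAt d x hx
    rw [Graph.sum_loopWeight hfin, h1, Set.ncard_eq_toFinset_card _ hfin.edgeSet_finite] at hle
    have h2 : (7 * G.order : ℚ) ≤ 8 * G.nu 2 := by
      have : 7 * G.order ≤ 8 * G.nu 2 := by omega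
      exact_mod_cast this
    exact ⟨by linarith, by omega⟩
  · have htriv := Graph.isTrivialCubic_of_edgeAdj hcubic hfin hconn hf hle hlg hne hfe hfg
    refine ⟨htriv, ?_⟩
    classical
    obtain ⟨hef, heg, hfg, hES, x, y, hxy, hVS, -⟩ := htriv
    have h1 : hfin.edgeSet_finite.toFinset = {e, f, g} := by
      ext d
      rw [Set.Finite.mem_toFinset, hES]
      simp
    have h2 : G₀.order = 2 := by rw [Graph.order, hVS, Set.ncard_pair hxy]
    rw [h1, Finset.sum_insert (by simp [hef, heg]), Finset.sum_pair hfg] at hn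
    rw [show G.nu 2 = k e + k f + k g + 1 by omega, show G.order = k e + k f + k g + 2 by omega]
  · have h1 : (5 * G.order : ℚ) ≤ 6 * G.nu 2 := by
      have : 5 * G.order ≤ 6 * G.nu 2 := by omega
      exact_mod_cast this
    linarith
  · rintro ⟨e, hE, hl, hke⟩
    exact he (hbig ⟨e, hE, by simp only [Graph.loopWeight, if_pos hl]; omega⟩)
  · rintro ⟨f, hE, hl, hkf⟩
    exact he (hbig ⟨f, hE, by simp only [Graph.loopWeight, if_neg hl]; omega⟩)
  -- Either `G` is in `𝔐`, where `6/13 > 3/7`, or `ν₂ ≥ 6n/7` and half of it suffices.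
  · have h1 : 3 * G.order ≤ 7 * G.nu 1 := by
      by_cases h : 2 * G.order < 7 * G₀.order
      · have := (hclass h).six_mul_order_le
        omega
      · omega
    have h2 : (3 * G.order : ℚ) ≤ 7 * G.nu 1 := by exact_mod_cast h1
    linarith
  · have h1 : (6 * G.order : ℚ) ≤ 13 * G.nu 1 := by exact_mod_cast hM.six_mul_order_le
    linarith
  · obtain ⟨h1, h2, -⟩ := hcut.parameters hfin hconn hcubic hk hk₂ hG hG'
    obtain ⟨h', h'', g, u₀, v₀, u, v, hc, -⟩ := hcut
    have h3 := hk e hc.loop.edge_mem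
    -- As `f` is not a loop, `k f + k e + 4 ≥ 7`, which pays for the two further vertices of `G₀`.
    have h4 := hk₂ f hc.link.edge_mem (by
      rintro ⟨x, hx⟩
      rcases hx.eq_and_eq_or_eq_and_eq hc.link with ⟨h, h'⟩ | ⟨h, h'⟩
      · exact hc.ne (h.symm.trans h')
      · exact hc.ne (h'.symm.trans h))
    have h5 : (7 * G₀'.order : ℚ) ≤ 2 * G'.order := by linarith
    have h6 : 7 * G₀'.order ≤ 2 * G'.order := by exact_mod_cast h5
    have h7 : (7 * G₀.order : ℚ) ≤ 2 * G.order := by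
      have : 7 * G₀.order ≤ 2 * G.order := by omega
      exact_mod_cast this
    linarith
  · refine hclass ?_
    have h1 : (2 * G.order : ℚ) < 7 * G₀.order := by linarith
    exact_mod_cast h1
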